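/- Let $M$ be a smooth manifold of dimension 4 with a smooth Riemannian metric $g$. Suppose that some metric $\tilde g=e^{2f}g$ in the conformal class of $g$ ($f\in C^\infty(M)$) admits a smooth parallel vector field $X$, i.e. $\tilde\nabla X=0$ for the Levi-Civita connection $\tilde\nabla$ of $\tilde g$, where $X$ is nontrivial, that is, not identically zero on any connected component of $M$. For $p\in M$ let $W_p:\Lambda^2T_pM\to\Lambda^2T_pM$ be the Weyl operator of $g$, determined by $\langle W_p(x\wedge y),z\wedge t\rangle=W(x,y,z,t)$, where $W$ is the $(0,4)$ Weyl tensor of $g$ and $\langle x\wedge y,z\wedge t\rangle=g(x,z)g(y,t)-g(x,t)g(y,z)$. Then, for every $p\in M$, the eigenvectors of $W_p$ can all be taken to be simple bivectors: $\Lambda^2T_pM$ has an orthonormal basis consisting of six eigenvectors of $W_p$, each of the form $v\wedge w$ with $v,w\in T_pM$. -/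

import Mathlib

open scoped Manifold ContDiff

noncomputable section

/-! ### Riemannian geometry in coordinates

`h` is a matrix-valued function of the coordinates `y = (y¹, …, yⁿ)`: the coefficients `g_ij`
of a Riemannian metric in a chart. -/

namespace Coord

variable {n : ℕ}

/-- The partial derivative `∂_i f` at `y`. -/
def pd (i : Fin n) (f : EuclideanSpace ℝ (Fin n) → ℝ) (y : EuclideanSpace ℝ (Fin n)) : ℝ :=
  fderiv ℝ f y (EuclideanSpace.single i 1)

variable (h : EuclideanSpace ℝ (Fin n) → Matrix (Fin n) (Fin n) ℝ)
  (y : EuclideanSpace ℝ (Fin n))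

/-- The inverse metric coefficients `g^{ij}`. -/
def inv (i j : Fin n) : ℝ := (h y)⁻¹ i j

/-- Christoffel symbols of the Levi-Civita connection,
`Γ^k_{ij} = ½ g^{kl} (∂_i g_{jl} + ∂_j g_{il} - ∂_l g_{ij})`, so `∇_{∂_i} ∂_j = Γ^k_{ij} ∂_k`. -/
def christoffel (k i j : Fin n) : ℝ :=
  (1 / 2) * ∑ l, inv h y k l *
    (pd i (fun z => h z j l) y + pd j (fun z => h z i l) y - pd l (fun z => h z i j) y)

/-- `riemannUp h y m l i j` is the `∂_m`-component of
`R(∂_i, ∂_j) ∂_l = ∇_{∂_i} ∇_{∂_j} ∂_l - ∇_{∂_j} ∇_{∂_i} ∂_l`. -/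
def riemannUp (m l i j : Fin n) : ℝ :=
  pd i (fun z => christoffel h z m j l) y - pd j (fun z => christoffel h z m i l) y
    + ∑ a, (christoffel h y m i a * christoffel h y a j l
      - christoffel h y m j a * christoffel h y a i l)

/-- The `(0,4)` curvature tensor, `R_{ijkl} = ⟨R(∂_i, ∂_j) ∂_l, ∂_k⟩` (sign such that
`R_{ijij}` is positive on round spheres). -/
def riemann (i j k l : Fin n) : ℝ := ∑ m, h y k m * riemannUp h y m l i j

/-- The Ricci tensor `Ric_{ik} = g^{jl} R_{ijkl}`. -/
def ricci (i k : Fin n) : ℝ := ∑ j, ∑ l, inv h y j l * riemann h y i j k l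

/-- The scalar curvature `s = g^{ij} Ric_{ij}`. -/
def scalar : ℝ := ∑ i, ∑ j, inv h y i j * ricci h y i j

/-- The Schouten tensor `S = (Ric - s g / (2 (n - 1))) / (n - 2)`. -/
def schouten (i j : Fin n) : ℝ :=
  (ricci h y i j - scalar h y * h y i j / (2 * ((n : ℝ) - 1))) / ((n : ℝ) - 2)

/-- The `(0,4)` Weyl tensor `W = R - S ∧ g`, where `∧` is the Kulkarni–Nomizu product. -/
def weyl (i j k l : Fin n) : ℝ :=
  riemann h y i j k l -
    (schouten h y i k * h y j l + h y i k * schouten h y j l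
      - schouten h y i l * h y j k - schouten h y j k * h y i l)

/-- The Weyl tensor with the last two indices raised,
`W_{ij}{}^{kl} = g^{ka} g^{lb} W_{ijab}`. -/
def weylUp (i j k l : Fin n) : ℝ :=
  ∑ a, ∑ b, inv h y k a * inv h y l b * weyl h y i j a b

end Coord

/-! ### Riemannian metrics on a manifold -/

section Manifold

variable {n : ℕ} {M : Type*} [TopologicalSpace M] [ChartedSpace (EuclideanSpace ℝ (Fin n)) M]

variable [IsManifold (𝓡 n) ∞ M]

/-- The coordinate vector field `∂_i` of the chart `φ` centred at `c`, at the point `q` of its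
domain: the tangent vector `dφ⁻¹(e_i)`. (The trivialization of the tangent bundle given by `c`
is the differential of `φ`.) -/
def coordVec (c q : M) (i : Fin n) : TangentSpace (𝓡 n) q :=
  (trivializationAt (EuclideanSpace ℝ (Fin n)) (TangentSpace (𝓡 n) : M → Type _) c).symmL ℝ q
    (EuclideanSpace.single i (1 : ℝ))

/-- The differential `dx^i` at `q` of the `i`-th coordinate of the chart centred at `c`: the
`i`-th component of `dφ(v)`. -/
def coordForm (c q : M) (i : Fin n) : Module.Dual ℝ (TangentSpace (𝓡 n) q) :=
  ((EuclideanSpace.proj i : EuclideanSpace ℝ (Fin n) →L[ℝ] ℝ) ∘L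
    (trivializationAt (EuclideanSpace ℝ (Fin n))
      (TangentSpace (𝓡 n) : M → Type _) c).continuousLinearMapAt ℝ q).toLinearMap

variable (n M) in
/-- Smooth Riemannian metrics on the `n`-dimensional smooth manifold `M`. -/
abbrev SmoothMetric : Type _ :=
  Bundle.ContMDiffRiemannianMetric (𝓡 n) ∞ (EuclideanSpace ℝ (Fin n))
    (fun p : M => TangentSpace (𝓡 n) p)

namespace SmoothMetric

/-- `gt` lies in the conformal class of `g`: `gt = e^{2f} g` for a smooth function `f`. -/
def IsConformal (g gt : SmoothMetric n M) : Prop :=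
  ∃ f : M → ℝ, ContMDiff (𝓡 n) 𝓘(ℝ) ∞ f ∧
    ∀ (p : M) (v w : TangentSpace (𝓡 n) p),
      gt.inner p v w = Real.exp (2 * f p) * g.inner p v w

/-- The coefficients `g_ij = g(∂_i, ∂_j)` of `g` in the chart centred at `c`. -/
def coeff (g : SmoothMetric n M) (c : M) (y : EuclideanSpace ℝ (Fin n)) :
    Matrix (Fin n) (Fin n) ℝ :=
  Matrix.of fun i j =>
    let q : M := (extChartAt (𝓡 n) c).symm y
    g.inner q (coordVec c q i) (coordVec c q j)

/-- A vector field `X` is parallel, `∇X = 0`: in every chart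
`∂_i X^k + Γ^k_{ij} X^j = 0` for all `i`, `k`. -/
def IsParallel (g : SmoothMetric n M) (X : (p : M) → TangentSpace (𝓡 n) p) : Prop :=
  ∀ (c : M), ∀ y ∈ (extChartAt (𝓡 n) c).target, ∀ i k : Fin n,
    let Xc : Fin n → EuclideanSpace ℝ (Fin n) → ℝ := fun j z =>
      coordForm c ((extChartAt (𝓡 n) c).symm z) j (X ((extChartAt (𝓡 n) c).symm z))
    Coord.pd i (Xc k) y + ∑ j, Coord.christoffel (g.coeff c) y k i j * Xc j y = 0

/-- The inner product induced by `g` on `Λ² T_pM`, given by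
`⟨x ∧ y, z ∧ t⟩ = g(x,z) g(y,t) - g(x,t) g(y,z)`. -/
def bivectorInner (g : SmoothMetric n M) (p : M) (α τ : ⋀[ℝ]^2 (TangentSpace (𝓡 n) p)) : ℝ :=
  exteriorPower.pairingDual ℝ (TangentSpace (𝓡 n) p) 2
    (exteriorPower.map 2 (ContinuousLinearMap.coeLM ℝ ∘ₗ (g.inner p).toLinearMap) α) τ

/-- The Weyl operator `W_p : Λ² T_pM → Λ² T_pM` of `g`,
`W_p = ¼ W_{ij}{}^{kl} (dx^i ∧ dx^j) ⊗ (∂_k ∧ ∂_l)`. Here `dx^i ∧ dx^j` acts on bivectors by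
`(dx^i ∧ dx^j)(x ∧ y) = x^i y^j - x^j y^i`, so that
`⟨W_p (x ∧ y), z ∧ t⟩ = W(x, y, z, t)`. It is computed in the chart centred at `p`. -/
def weylOperator (g : SmoothMetric n M) (p : M) :
    Module.End ℝ (⋀[ℝ]^2 (TangentSpace (𝓡 n) p)) :=
  let u : EuclideanSpace ℝ (Fin n) := extChartAt (𝓡 n) p p
  ∑ i, ∑ j, ∑ k, ∑ l, (Coord.weylUp (g.coeff p) u i j k l / 4) •
    (exteriorPower.pairingDual ℝ (TangentSpace (𝓡 n) p) 2
      (exteriorPower.ιMulti ℝ 2 ![coordForm p p i, coordForm p p j])).smulRight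
        (exteriorPower.ιMulti ℝ 2 ![coordVec p p k, coordVec p p l])

end SmoothMetric

end Manifold

/-- A bivector is simple if it is of the form `v ∧ w`. -/
def IsSimpleBivector {V : Type*} [AddCommGroup V] [Module ℝ V] (α : ⋀[ℝ]^2 V) : Prop :=
  ∃ v w : V, α = exteriorPower.ιMulti ℝ 2 ![v, w]

end

/-! The Weyl operator has the same eigenvectors for conformal metrics, so it can be diagonalized for
`gt`, where a parallel field `X` is available. A parallel field has constant length
(`IsParallel.isLocallyConstant_normSq`), hence vanishes nowhere under the nontriviality hypothesis.
Equality of its mixed partial derivatives says that the curvature annihilates it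
(`sum_riemann_mul_eq_zero`).

At `p` the curvature of `gt` therefore lives on the three-dimensional complement of `X p`, where a
curvature tensor is determined by its Ricci tensor. Ricci also annihilates `X p`, so a
`gt`-orthonormal frame containing a multiple of `X p` diagonalizes it
(`Matrix.PosDef.exists_frame`). In this frame a component `R_abcb` with `a ≠ c` is a whole
off-diagonal Ricci entry or has an index along `X`; there is no room for four distinct indices away
from `X`. So only the components `R_abab`, up to sign, survive (`eq_zero_of_pairs_ne`). The Schouten
tensor is diagonal too, and the Kulkarni–Nomizu product of diagonal forms has the same shape, so
each `e_a ∧ e_b` is an eigenvector of the Weyl operator of `gt` (`exists_frame_weylUp`).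

To return to `g`, the coordinate formula for the conformal change of curvature
(`exists_riemann_conformal`) shows that `W_{ij}{}^{kl}` only acquires a factor (`weylUp_conformal`).
Rescaling the frame by `e^f` makes it `g`-orthonormal, and its six wedges form the required basis.
-/

namespace Coord

variable {n : ℕ}

/-! ### Calculus of partial derivatives on open subsets of Euclidean space. -/

section PartialDerivatives

variable {f f' : EuclideanSpace ℝ (Fin n) → ℝ} {y : EuclideanSpace ℝ (Fin n)}
  {U : Set (EuclideanSpace ℝ (Fin n))}

lemma pd_add (i : Fin n) (hf : DifferentiableAt ℝ f y) (hf' : DifferentiableAt ℝ f' y) :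
    pd i (fun z => f z + f' z) y = pd i f y + pd i f' y := by
  simp [pd, fderiv_fun_add hf hf']

lemma pd_sub (i : Fin n) (hf : DifferentiableAt ℝ f y) (hf' : DifferentiableAt ℝ f' y) :
    pd i (fun z => f z - f' z) y = pd i f y - pd i f' y := by
  simp [pd, fderiv_fun_sub hf hf']

lemma pd_mul (i : Fin n) (hf : DifferentiableAt ℝ f y) (hf' : DifferentiableAt ℝ f' y) :
    pd i (fun z => f z * f' z) y = pd i f y * f' y + f y * pd i f' y := by
  simp [pd, fderiv_fun_mul hf hf']
  ring

lemma pd_const_mul (i : Fin n) (c : ℝ) (hf : DifferentiableAt ℝ f y) :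
    pd i (fun z => c * f z) y = c * pd i f y := by
  simp [pd, fderiv_const_mul hf]

lemma pd_sum {ι : Type*} (s : Finset ι) (i : Fin n) {F : ι → EuclideanSpace ℝ (Fin n) → ℝ}
    (hF : ∀ a ∈ s, DifferentiableAt ℝ (F a) y) :
    pd i (fun z => ∑ a ∈ s, F a z) y = ∑ a ∈ s, pd i (F a) y := by
  simp [pd, fderiv_fun_sum hF]

lemma pd_congr (hU : IsOpen U) (hy : y ∈ U) (i : Fin n) (hff' : Set.EqOn f f' U) :
    pd i f y = pd i f' y := by
  have : f =ᶠ[nhds y] f' := Filter.eventuallyEq_of_mem (hU.mem_nhds hy) hff'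
  simp [pd, this.fderiv_eq]

lemma pd_exp (i : Fin n) (hf : DifferentiableAt ℝ f y) :
    pd i (fun z => Real.exp (f z)) y = Real.exp (f y) * pd i f y := by
  simp [pd, fderiv_exp hf]

lemma differentiableAt_of_contDiffOn (hU : IsOpen U) (hf : ContDiffOn ℝ ∞ f U) (hy : y ∈ U) :
    DifferentiableAt ℝ f y :=
  (hf.contDiffAt (hU.mem_nhds hy)).differentiableAt (by simp)

lemma contDiffOn_pd (hU : IsOpen U) (hf : ContDiffOn ℝ ∞ f U) (i : Fin n) :
    ContDiffOn ℝ ∞ (pd i f) U :=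
  (hf.fderiv_of_isOpen hU (m := ∞) (by simp)).clm_apply contDiffOn_const

lemma pd_comm (hU : IsOpen U) (hf : ContDiffOn ℝ ∞ f U) (hy : y ∈ U) (i j : Fin n) :
    pd i (pd j f) y = pd j (pd i f) y := by
  have hfy : ContDiffAt ℝ ∞ f y := hf.contDiffAt (hU.mem_nhds hy)
  have hd : DifferentiableAt ℝ (fderiv ℝ f) y :=
    (hfy.fderiv_right (m := ∞) (by simp)).differentiableAt (by simp)
  have hs := (hfy.isSymmSndFDerivAt (by simp; exact WithTop.coe_le_coe.2 le_top)).eq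
    (EuclideanSpace.single i 1) (EuclideanSpace.single j 1)
  have key : ∀ a b : Fin n, pd a (pd b f) y =
      fderiv ℝ (fderiv ℝ f) y (EuclideanSpace.single a 1) (EuclideanSpace.single b 1) := by
    intro a b
    unfold pd
    rw [fderiv_clm_apply hd (differentiableAt_const _)]
    simp
  rw [key, key, hs]

lemma contDiffOn_det {m : Type*} [Fintype m] [DecidableEq m]
    {A : EuclideanSpace ℝ (Fin n) → Matrix m m ℝ}
    (hA : ∀ i j, ContDiffOn ℝ ∞ (fun z => A z i j) U) : ContDiffOn ℝ ∞ (fun z => (A z).det) U := by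
  simp only [Matrix.det_apply']
  exact ContDiffOn.sum fun σ _ => contDiffOn_const.mul (contDiffOn_prod fun i _ => hA _ _)

end PartialDerivatives

/-- `h` is a smooth field of symmetric nondegenerate matrices on the open set `U`. -/
structure IsMetricOn (h : EuclideanSpace ℝ (Fin n) → Matrix (Fin n) (Fin n) ℝ)
    (U : Set (EuclideanSpace ℝ (Fin n))) : Prop where
  isOpen : IsOpen U
  smooth : ∀ i j, ContDiffOn ℝ ∞ (fun z => h z i j) U
  symm : ∀ z ∈ U, ∀ i j, h z i j = h z j i
  isUnit_det : ∀ z ∈ U, IsUnit (h z).det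

/-! ### Levi-Civita connection and curvature symmetries in coordinates. -/

namespace IsMetricOn

variable {h : EuclideanSpace ℝ (Fin n) → Matrix (Fin n) (Fin n) ℝ}
  {U : Set (EuclideanSpace ℝ (Fin n))} {y : EuclideanSpace ℝ (Fin n)}

/-- Cramer's rule: adjugate entries are determinants of smooth matrices, and the determinant does
not vanish on `U`. -/
lemma contDiffOn_inv (hh : IsMetricOn h U) (i j : Fin n) :
    ContDiffOn ℝ ∞ (fun z => inv h z i j) U := by
  have hadj : ContDiffOn ℝ ∞ (fun z => (h z).adjugate i j) U := by
    simp only [Matrix.adjugate_apply]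
    refine contDiffOn_det fun a b => ?_
    simp only [Matrix.updateRow_apply]
    split_ifs
    · exact contDiffOn_const
    · exact hh.smooth a b
  have : Set.EqOn (fun z => inv h z i j) (fun z => ((h z).det)⁻¹ * (h z).adjugate i j) U := by
    intro z _
    simp [inv, Matrix.inv_def, Ring.inverse_eq_inv']
  refine ContDiffOn.congr ?_ this
  exact ((contDiffOn_det hh.smooth).inv fun z hz => (hh.isUnit_det z hz).ne_zero).mul hadj

lemma contDiffOn_christoffel (hh : IsMetricOn h U) (k i j : Fin n) :
    ContDiffOn ℝ ∞ (fun z => christoffel h z k i j) U := by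
  refine contDiffOn_const.mul (ContDiffOn.sum fun l _ => (hh.contDiffOn_inv k l).mul ?_)
  exact ((contDiffOn_pd hh.isOpen (hh.smooth j l) i).add
    (contDiffOn_pd hh.isOpen (hh.smooth i l) j)).sub (contDiffOn_pd hh.isOpen (hh.smooth i j) l)

lemma pd_symm (hh : IsMetricOn h U) (hy : y ∈ U) (i j k : Fin n) :
    pd i (fun z => h z j k) y = pd i (fun z => h z k j) y :=
  pd_congr hh.isOpen hy i fun z hz => hh.symm z hz j k

lemma christoffel_symm (hh : IsMetricOn h U) (hy : y ∈ U) (k i j : Fin n) :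
    christoffel h y k i j = christoffel h y k j i := by
  simp only [christoffel, hh.pd_symm hy _ i j]
  congr 1
  exact Finset.sum_congr rfl fun l _ => by ring

lemma sum_mul_inv (hh : IsMetricOn h U) (hy : y ∈ U) (i k : Fin n) :
    ∑ j, h y i j * inv h y j k = if i = k then 1 else 0 := by
  have := congrFun₂ (Matrix.mul_nonsing_inv (h y) (hh.isUnit_det y hy)) i k
  simpa only [inv, Matrix.mul_apply, Matrix.one_apply] using this

lemma sum_inv_mul (hh : IsMetricOn h U) (hy : y ∈ U) (i k : Fin n) :
    ∑ j, inv h y i j * h y j k = if i = k then 1 else 0 := by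
  have := congrFun₂ (Matrix.nonsing_inv_mul (h y) (hh.isUnit_det y hy)) i k
  simpa only [inv, Matrix.mul_apply, Matrix.one_apply] using this

lemma inv_symm (hh : IsMetricOn h U) (hy : y ∈ U) (i k : Fin n) :
    inv h y i k = inv h y k i := by
  have ht : (h y).transpose = h y := by
    ext i j
    exact hh.symm y hy j i
  have := congrFun₂ (Matrix.transpose_nonsing_inv (h y)) k i
  rw [ht] at this
  simpa [inv] using this

/-- Lowering an index after raising it with `inv`. -/
lemma sum_mul_sum_inv (hh : IsMetricOn h U) (hy : y ∈ U) (k : Fin n) (v : Fin n → ℝ) :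
    ∑ m, h y k m * ∑ l, inv h y m l * v l = v k := by
  simp_rw [Finset.mul_sum, ← mul_assoc]
  rw [Finset.sum_comm]
  simp_rw [← Finset.sum_mul, hh.sum_mul_inv hy]
  simp

lemma sum_mul_christoffel (hh : IsMetricOn h U) (hy : y ∈ U) (k i j : Fin n) :
    ∑ m, h y k m * christoffel h y m i j = (1 / 2) * (pd i (fun z => h z j k) y
      + pd j (fun z => h z i k) y - pd k (fun z => h z i j) y) := by
  simp only [christoffel, mul_left_comm _ (1 / 2 : ℝ), ← Finset.mul_sum]
  rw [hh.sum_mul_sum_inv hy k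
    (fun l => pd i (fun z => h z j l) y + pd j (fun z => h z i l) y - pd l (fun z => h z i j) y)]

/-- The metric is parallel. -/
lemma pd_metric (hh : IsMetricOn h U) (hy : y ∈ U) (i j k : Fin n) :
    pd i (fun z => h z j k) y =
      ∑ m, (h y k m * christoffel h y m i j + h y j m * christoffel h y m i k) := by
  rw [Finset.sum_add_distrib, hh.sum_mul_christoffel hy, hh.sum_mul_christoffel hy,
    hh.pd_symm hy i k j, hh.pd_symm hy j i k, hh.pd_symm hy k i j]
  ring

lemma differentiableAt_metric (hh : IsMetricOn h U) (hy : y ∈ U) (i j : Fin n) :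
    DifferentiableAt ℝ (fun z => h z i j) y :=
  differentiableAt_of_contDiffOn hh.isOpen (hh.smooth i j) hy

lemma differentiableAt_christoffel (hh : IsMetricOn h U) (hy : y ∈ U) (k i j : Fin n) :
    DifferentiableAt ℝ (fun z => christoffel h z k i j) y :=
  differentiableAt_of_contDiffOn hh.isOpen (hh.contDiffOn_christoffel k i j) hy

/-- Metric compatibility splits the sum into the quadratic term of the curvature and a Gram term
`h(Γ_ik, Γ_jl)`. The latter is symmetric under exchange of the two pairs, which is what makes it
drop out of the commutator of second derivatives. -/
lemma sum_pd_metric_mul_christoffel (hh : IsMetricOn h U) (hy : y ∈ U) (i j k l : Fin n) :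
    ∑ m, pd i (fun z => h z k m) y * christoffel h y m j l =
      (∑ m, ∑ a, h y k m * (christoffel h y m i a * christoffel h y a j l)) +
      ∑ m, ∑ a, h y m a * christoffel h y a i k * christoffel h y m j l := by
  simp only [hh.pd_metric hy, Finset.sum_mul, add_mul, Finset.sum_add_distrib]
  rw [add_comm]
  congr 1
  rw [Finset.sum_comm]
  exact Finset.sum_congr rfl fun _ _ => Finset.sum_congr rfl fun _ _ => by ring

lemma pd_pd_metric (hh : IsMetricOn h U) (hy : y ∈ U) (i j k l : Fin n) :
    pd i (pd j (fun z => h z k l)) y =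
      (∑ m, pd i (fun z => h z l m) y * christoffel h y m j k
        + ∑ m, h y l m * pd i (fun z => christoffel h z m j k) y)
      + (∑ m, pd i (fun z => h z k m) y * christoffel h y m j l
        + ∑ m, h y k m * pd i (fun z => christoffel h z m j l) y) := by
  rw [pd_congr hh.isOpen hy i (fun z hz => hh.pd_metric hz j k l)]
  have hd : ∀ a b m c d, DifferentiableAt ℝ (fun z => h z a b * christoffel h z m c d) y :=
    fun a b m c d => (hh.differentiableAt_metric hy a b).mul (hh.differentiableAt_christoffel hy m c d)
  rw [pd_sum Finset.univ i (F := fun m z => h z l m * christoffel h z m j k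
    + h z k m * christoffel h z m j l) fun m _ => (hd _ _ _ _ _).fun_add (hd _ _ _ _ _), ← Finset.sum_add_distrib,
    ← Finset.sum_add_distrib, ← Finset.sum_add_distrib]
  refine Finset.sum_congr rfl fun m _ => ?_
  rw [pd_add i (hd _ _ _ _ _) (hd _ _ _ _ _),
    pd_mul i (hh.differentiableAt_metric hy _ _) (hh.differentiableAt_christoffel hy _ _ _),
    pd_mul i (hh.differentiableAt_metric hy _ _) (hh.differentiableAt_christoffel hy _ _ _)]

lemma riemann_eq (h : EuclideanSpace ℝ (Fin n) → Matrix (Fin n) (Fin n) ℝ)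
    (y : EuclideanSpace ℝ (Fin n)) (i j k l : Fin n) : riemann h y i j k l =
      (∑ m, h y k m * pd i (fun z => christoffel h z m j l) y
        - ∑ m, h y k m * pd j (fun z => christoffel h z m i l) y)
      + ((∑ m, ∑ a, h y k m * (christoffel h y m i a * christoffel h y a j l))
        - ∑ m, ∑ a, h y k m * (christoffel h y m j a * christoffel h y a i l)) := by
  simp only [riemann, riemannUp, Finset.sum_sub_distrib, mul_add, mul_sub, Finset.sum_add_distrib,
    Finset.mul_sum]

lemma riemann_antisymm_left (h : EuclideanSpace ℝ (Fin n) → Matrix (Fin n) (Fin n) ℝ)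
    (y : EuclideanSpace ℝ (Fin n)) (i j k l : Fin n) :
    riemann h y i j k l = -riemann h y j i k l := by
  rw [riemann_eq, riemann_eq]
  ring

/-- This is the commutation of `∂_i` and `∂_j` on `h_kl`: once the derivatives are expressed through
`Γ`, the commutator is `R_ijkl + R_ijlk`, and the Gram terms cancel by `hN`. -/
lemma riemann_antisymm_right (hh : IsMetricOn h U) (hy : y ∈ U) (i j k l : Fin n) :
    riemann h y i j k l = -riemann h y i j l k := by
  have hN : ∀ i j k l, ∑ m, ∑ a, h y m a * christoffel h y a i k * christoffel h y m j l
      = ∑ m, ∑ a, h y m a * christoffel h y a j l * christoffel h y m i k := by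
    intro i j k l
    rw [Finset.sum_comm]
    refine Finset.sum_congr rfl fun m _ => Finset.sum_congr rfl fun a _ => ?_
    rw [hh.symm y hy m a]
    ring
  have hs := pd_comm hh.isOpen (hh.smooth k l) hy i j
  simp only [hh.pd_pd_metric hy, hh.sum_pd_metric_mul_christoffel hy] at hs
  rw [riemann_eq, riemann_eq]
  have h1 := hN i j k l
  have h2 := hN i j l k
  linarith

/-- Only the symmetry of `Γ` in its lower indices (no torsion) is needed: it cancels derivative
terms and quadratic terms separately. -/
lemma riemannUp_bianchi (hh : IsMetricOn h U) (hy : y ∈ U) (m i j l : Fin n) :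
    riemannUp h y m l i j + riemannUp h y m i j l + riemannUp h y m j l i = 0 := by
  have hs : ∀ i m j l, pd i (fun z => christoffel h z m j l) y
      = pd i (fun z => christoffel h z m l j) y := fun i m j l =>
    pd_congr hh.isOpen hy i fun z hz => hh.christoffel_symm hz m j l
  simp only [riemannUp]
  rw [hs j m i l, hs i m l j, hs l m j i]
  have : ∑ a, (christoffel h y m i a * christoffel h y a j l
      - christoffel h y m j a * christoffel h y a i l)
      + ∑ a, (christoffel h y m j a * christoffel h y a l i
      - christoffel h y m l a * christoffel h y a j i)
      + ∑ a, (christoffel h y m l a * christoffel h y a i j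
      - christoffel h y m i a * christoffel h y a l j) = 0 := by
    rw [← Finset.sum_add_distrib, ← Finset.sum_add_distrib]
    refine Finset.sum_eq_zero fun a _ => ?_
    rw [hh.christoffel_symm hy a j l, hh.christoffel_symm hy a i l, hh.christoffel_symm hy a j i]
    ring
  linarith

lemma riemann_bianchi (hh : IsMetricOn h U) (hy : y ∈ U) (i j k l : Fin n) :
    riemann h y i j k l + riemann h y j l k i + riemann h y l i k j = 0 := by
  simp only [riemann, ← Finset.sum_add_distrib, ← mul_add, hh.riemannUp_bianchi hy, mul_zero,
    Finset.sum_const_zero]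

/-- Symmetry under exchange of pairs. -/
lemma riemann_pair_symm (hh : IsMetricOn h U) (hy : y ∈ U) (i j k l : Fin n) :
    riemann h y i j k l = riemann h y k l i j := by
  have hl := riemann_antisymm_left h y
  have hr := hh.riemann_antisymm_right hy
  have hb := hh.riemann_bianchi hy
  -- The classical octahedron argument: four Bianchi identities, one for each index kept in the
  -- third slot, combined through the antisymmetries.
  linarith [hb i j k l, hb j k l i, hb k l i j, hb l i j k, hl i j k l, hl i l k j, hl j k l i,
    hl i k j l, hl l i j k, hl k j i l, hl k l i j, hr i j k l, hr j l i k, hr k l i j, hr j l k i,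
    hr l i k j, hr i k j l, hr i k l j, hr j k l i, hr k j i l, hl j l i k, hl k i l j,
    hr l j k i, hr l j i k, hr i l k j, hr j i k l, hl l k i j, hl l k j i, hr k i j l,
    hl l j i k, hr k i l j, hr l i j k, hl j k i l, hl l i k j]

end IsMetricOn

end Coord

namespace Coord

/-! ### Gradient, Hessian and Kulkarni–Nomizu product. -/

section Notions

variable {n : ℕ}

/-- The gradient of `f`. -/
noncomputable def grad (h : EuclideanSpace ℝ (Fin n) → Matrix (Fin n) (Fin n) ℝ)
    (f : EuclideanSpace ℝ (Fin n) → ℝ) (y : EuclideanSpace ℝ (Fin n)) (k : Fin n) : ℝ :=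
  ∑ a, inv h y k a * pd a f y

/-- The Kronecker symbol. -/
noncomputable def kron (i j : Fin n) : ℝ := if i = j then 1 else 0

/-- The Hessian `∇df`. -/
noncomputable def hess (h : EuclideanSpace ℝ (Fin n) → Matrix (Fin n) (Fin n) ℝ)
    (f : EuclideanSpace ℝ (Fin n) → ℝ) (y : EuclideanSpace ℝ (Fin n)) (i j : Fin n) : ℝ :=
  pd i (pd j f) y - ∑ a, christoffel h y a i j * pd a f y

/-- The covariant derivative of the gradient. -/
noncomputable def covGrad (h : EuclideanSpace ℝ (Fin n) → Matrix (Fin n) (Fin n) ℝ)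
    (f : EuclideanSpace ℝ (Fin n) → ℝ) (y : EuclideanSpace ℝ (Fin n)) (m i : Fin n) : ℝ :=
  pd i (fun z => grad h f z m) y + ∑ a, christoffel h y m i a * grad h f y a

/-- The Kulkarni–Nomizu product of `h` with a bilinear form. -/
noncomputable def kulkarni (h A : Fin n → Fin n → ℝ) (i j k l : Fin n) : ℝ :=
  A i k * h j l + h i k * A j l - A i l * h j k - A j k * h i l

lemma sum_kron_mul (i : Fin n) (v : Fin n → ℝ) : ∑ a, kron i a * v a = v i := by
  simp [kron]

lemma sum_kron_mul' (i : Fin n) (v : Fin n → ℝ) : ∑ a, kron a i * v a = v i := by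
  simp [kron]

end Notions

namespace IsMetricOn

variable {n : ℕ} {h ht : EuclideanSpace ℝ (Fin n) → Matrix (Fin n) (Fin n) ℝ}
  {U : Set (EuclideanSpace ℝ (Fin n))} {y : EuclideanSpace ℝ (Fin n)}

/-! ### Parallel vector fields -/

section Parallel

variable {X : Fin n → EuclideanSpace ℝ (Fin n) → ℝ}

/-- The curvature annihilates a parallel vector field. -/
lemma sum_riemann_mul_eq_zero (hh : IsMetricOn h U) (hy : y ∈ U)
    (hX : ∀ k, ContDiffOn ℝ ∞ (X k) U)
    (hpar : ∀ z ∈ U, ∀ i k, pd i (X k) z + ∑ j, christoffel h z k i j * X j z = 0)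
    (i j k : Fin n) : ∑ l, riemann h y i j k l * X l y = 0 := by
  have hXd : ∀ k, DifferentiableAt ℝ (X k) y := fun k =>
    differentiableAt_of_contDiffOn hh.isOpen (hX k) hy
  have hpd : ∀ z ∈ U, ∀ i k, pd i (X k) z = -1 * ∑ j, christoffel h z k i j * X j z :=
    fun z hz i k => by linarith [hpar z hz i k]
  have hd : ∀ k i j, DifferentiableAt ℝ (fun z => christoffel h z k i j * X j z) y :=
    fun k i j => (hh.differentiableAt_christoffel hy k i j).mul (hXd j)
  -- The parallel equation is used twice, so second derivatives of `X` involve only `Γ`, `∂Γ` and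
  -- `X`. Equality of mixed partials then becomes `R(∂_i, ∂_j) X = 0`.
  have h2 : ∀ i j m, pd i (pd j (X m)) y =
      (∑ a, ∑ l, christoffel h y m j a * (christoffel h y a i l * X l y))
      - ∑ l, pd i (fun z => christoffel h z m j l) y * X l y := by
    intro i j m
    rw [pd_congr hh.isOpen hy i (fun z hz => hpd z hz j m), pd_const_mul i,
      pd_sum Finset.univ i (F := fun l z => christoffel h z m j l * X l z) fun l _ => hd m j l]
    · simp only [pd_mul i (hh.differentiableAt_christoffel hy _ _ _) (hXd _), hpd y hy,
        Finset.sum_add_distrib, Finset.mul_sum]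
      simp only [mul_neg, neg_mul, one_mul, Finset.sum_neg_distrib]
      ring
    · exact DifferentiableAt.fun_sum fun l _ => hd m j l
  have hup : ∀ m, ∑ l, riemannUp h y m l i j * X l y = 0 := by
    intro m
    have hc := pd_comm hh.isOpen (hX m) hy i j
    rw [h2, h2, Finset.sum_comm, Finset.sum_comm (γ := Fin n) (f := fun a l =>
      christoffel h y m i a * (christoffel h y a j l * X l y))] at hc
    simp only [riemannUp, add_mul, sub_mul, Finset.sum_add_distrib, Finset.sum_sub_distrib,
      Finset.sum_mul, mul_assoc]
    linarith
  simp only [riemann, Finset.sum_mul, mul_assoc]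
  rw [Finset.sum_comm]
  simp only [← Finset.mul_sum, hup, mul_zero, Finset.sum_const_zero]

/-- A parallel vector field has constant length. -/
lemma pd_normSq_eq_zero (hh : IsMetricOn h U) (hy : y ∈ U)
    (hX : ∀ k, ContDiffOn ℝ ∞ (X k) U)
    (hpar : ∀ z ∈ U, ∀ i k, pd i (X k) z + ∑ j, christoffel h z k i j * X j z = 0)
    (i : Fin n) : pd i (fun z => ∑ k, ∑ l, h z k l * (X k z * X l z)) y = 0 := by
  have hXd : ∀ k, DifferentiableAt ℝ (X k) y := fun k =>
    differentiableAt_of_contDiffOn hh.isOpen (hX k) hy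
  have hpd : ∀ k, pd i (X k) y = -∑ j, christoffel h y k i j * X j y :=
    fun k => by linarith [hpar y hy i k]
  have hd : ∀ k l, DifferentiableAt ℝ (fun z => h z k l * (X k z * X l z)) y :=
    fun k l => (hh.differentiableAt_metric hy k l).mul ((hXd k).mul (hXd l))
  rw [pd_sum Finset.univ i (F := fun k z => ∑ l, h z k l * (X k z * X l z))
    fun k _ => DifferentiableAt.fun_sum fun l _ => hd k l]
  have h1 : ∀ k, pd i (fun z => ∑ l, h z k l * (X k z * X l z)) y =
      ∑ l, (pd i (fun z => h z k l) y * (X k y * X l y) + h y k l *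
        (pd i (X k) y * X l y + X k y * pd i (X l) y)) := by
    intro k
    rw [pd_sum Finset.univ i (F := fun l z => h z k l * (X k z * X l z)) fun l _ => hd k l]
    refine Finset.sum_congr rfl fun l _ => ?_
    rw [pd_mul i (hh.differentiableAt_metric hy k l) ((hXd k).fun_mul (hXd l)), pd_mul i (hXd k) (hXd l)]
  simp only [h1, hh.pd_metric hy, hpd, mul_add, add_mul, Finset.sum_add_distrib, Finset.sum_mul,
    Finset.mul_sum, mul_neg, neg_mul, Finset.sum_neg_distrib]
  -- Metric compatibility turns the derivative of `h` into two terms; `e1` and `e2` identify them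
  -- with those coming from the derivatives of the two factors `X`.
  have e1 : ∑ k, ∑ l, ∑ m, h y l m * christoffel h y m i k * (X k y * X l y)
      = ∑ k, ∑ l, ∑ j, h y k l * (christoffel h y k i j * X j y * X l y) := by
    calc _ = ∑ k, ∑ m, ∑ l, h y l m * christoffel h y m i k * (X k y * X l y) :=
          Finset.sum_congr rfl fun k _ => Finset.sum_comm
      _ = ∑ m, ∑ k, ∑ l, h y l m * christoffel h y m i k * (X k y * X l y) := Finset.sum_comm
      _ = ∑ m, ∑ l, ∑ k, h y l m * christoffel h y m i k * (X k y * X l y) :=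
          Finset.sum_congr rfl fun k _ => Finset.sum_comm
      _ = _ := Finset.sum_congr rfl fun m _ => Finset.sum_congr rfl fun l _ =>
          Finset.sum_congr rfl fun k _ => by rw [hh.symm y hy l m]; ring
  have e2 : ∑ k, ∑ l, ∑ m, h y k m * christoffel h y m i l * (X k y * X l y)
      = ∑ k, ∑ l, ∑ j, h y k l * (X k y * (christoffel h y l i j * X j y)) := by
    refine Finset.sum_congr rfl fun k _ => ?_
    rw [Finset.sum_comm]
    exact Finset.sum_congr rfl fun m _ => Finset.sum_congr rfl fun l _ => by ring
  rw [e1, e2]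
  ring

end Parallel

/-! ### Conformal change of metric -/

section Conformal

variable {f : EuclideanSpace ℝ (Fin n) → ℝ}

lemma inv_conformal (hh : IsMetricOn h U) (hy : y ∈ U) {c : ℝ} (hc : c ≠ 0)
    (hht : ∀ i j, ht y i j = c * h y i j) (i j : Fin n) :
    inv ht y i j = c⁻¹ * inv h y i j := by
  have e : ht y = c • h y := by
    ext i j
    simp [hht]
  have : (ht y)⁻¹ = c⁻¹ • (h y)⁻¹ := by
    apply Matrix.inv_eq_left_inv
    rw [e, Matrix.smul_mul, Matrix.mul_smul, Matrix.nonsing_inv_mul _ (hh.isUnit_det y hy),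
      smul_smul, inv_mul_cancel₀ hc, one_smul]
  simp only [inv, this]
  rfl

lemma pd_conformal (hh : IsMetricOn h U) (hf : ContDiffOn ℝ ∞ f U)
    (hht : ∀ z ∈ U, ∀ i j, ht z i j = Real.exp (2 * f z) * h z i j) (hy : y ∈ U) (i j k : Fin n) :
    pd i (fun z => ht z j k) y =
      Real.exp (2 * f y) * (2 * pd i f y * h y j k + pd i (fun z => h z j k) y) := by
  have hfd := differentiableAt_of_contDiffOn hh.isOpen hf hy
  rw [pd_congr hh.isOpen hy i (fun z hz => hht z hz j k),
    pd_mul i (hfd.const_mul 2).exp (hh.differentiableAt_metric hy j k),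
    pd_exp i (hfd.const_mul 2), pd_const_mul i 2 hfd]
  ring

lemma sum_mul_grad (hh : IsMetricOn h U) (hy : y ∈ U) (k : Fin n) :
    ∑ m, h y k m * grad h f y m = pd k f y :=
  hh.sum_mul_sum_inv hy k _

lemma contDiffOn_grad (hh : IsMetricOn h U) (hf : ContDiffOn ℝ ∞ f U) (k : Fin n) :
    ContDiffOn ℝ ∞ (fun z => grad h f z k) U :=
  ContDiffOn.sum fun a _ => (hh.contDiffOn_inv k a).mul (contDiffOn_pd hh.isOpen hf a)

lemma christoffel_conformal (hh : IsMetricOn h U) (hf : ContDiffOn ℝ ∞ f U)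
    (hht : ∀ z ∈ U, ∀ i j, ht z i j = Real.exp (2 * f z) * h z i j) (hy : y ∈ U) (k i j : Fin n) :
    christoffel ht y k i j = christoffel h y k i j +
      (kron k i * pd j f y + kron k j * pd i f y - h y i j * grad h f y k) := by
  -- The Kronecker symbols are written as contractions of `g⁻¹` with `g`, so that the identity can
  -- be checked for each summand in `l`.
  have h1 : ∀ i, kron k i = ∑ l, inv h y k l * h y i l := by
    intro i
    simp only [hh.symm y hy i, hh.sum_inv_mul hy, kron]
  simp only [christoffel, pd_conformal hh hf hht hy, h1, grad, Finset.mul_sum, Finset.sum_mul]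
  rw [← Finset.sum_add_distrib, ← Finset.sum_sub_distrib, ← Finset.sum_add_distrib]
  refine Finset.sum_congr rfl fun l _ => ?_
  rw [hh.inv_conformal hy (Real.exp_ne_zero _) (hht y hy)]
  have := Real.exp_ne_zero (2 * f y)
  field_simp
  ring

/-- Covariant differentiation commutes with lowering an index: differentiate `h · grad f = df` and
use that the metric is parallel. -/
lemma sum_mul_covGrad (hh : IsMetricOn h U) (hf : ContDiffOn ℝ ∞ f U) (hy : y ∈ U) (k i : Fin n) :
    ∑ m, h y k m * covGrad h f y m i = hess h f y i k := by
  have hg : ∀ m, DifferentiableAt ℝ (fun z => grad h f z m) y := fun m =>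
    differentiableAt_of_contDiffOn hh.isOpen (hh.contDiffOn_grad hf m) hy
  have h1 : pd i (pd k f) y = ∑ m, (pd i (fun z => h z k m) y * grad h f y m
      + h y k m * pd i (fun z => grad h f z m) y) := by
    rw [← pd_congr hh.isOpen hy i (fun z hz => hh.sum_mul_grad hz k),
      pd_sum Finset.univ i (F := fun m z => h z k m * grad h f z m)
        fun m _ => (hh.differentiableAt_metric hy k m).mul (hg m)]
    exact Finset.sum_congr rfl fun m _ => pd_mul i (hh.differentiableAt_metric hy k m) (hg m)
  have h2 : ∑ m, pd i (fun z => h z k m) y * grad h f y m =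
      ∑ a, christoffel h y a i k * pd a f y
        + ∑ m, h y k m * ∑ a, christoffel h y m i a * grad h f y a := by
    simp only [hh.pd_metric hy, ← hh.sum_mul_grad (f := f) hy, Finset.sum_mul, Finset.mul_sum,
      add_mul, Finset.sum_add_distrib]
    congr 1
    · rw [Finset.sum_comm]
      exact Finset.sum_congr rfl fun m _ => Finset.sum_congr rfl fun a _ => by
        rw [hh.symm y hy m a]; ring
    · rw [Finset.sum_comm]
      exact Finset.sum_congr rfl fun m _ => Finset.sum_congr rfl fun a _ => by ring
  rw [hess, h1, Finset.sum_add_distrib, h2]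
  simp only [covGrad, mul_add, Finset.sum_add_distrib]
  ring

/-- With `D` the difference of the two connections, the curvature changes by the antisymmetrized
`∇D` plus a commutator quadratic in `D`. The mixed products `Γ · D` complete the partial derivatives
to the covariant ones in `hess` and `covGrad`. -/
lemma riemannUp_conformal (hh : IsMetricOn h U) (hf : ContDiffOn ℝ ∞ f U)
    (hht : ∀ z ∈ U, ∀ i j, ht z i j = Real.exp (2 * f z) * h z i j) (hy : y ∈ U)
    (m l i j : Fin n) :
    riemannUp ht y m l i j = riemannUp h y m l i j +
      (kron m j * hess h f y i l - kron m i * hess h f y j l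
      - h y j l * covGrad h f y m i + h y i l * covGrad h f y m j
      + kron m i * (pd j f y * pd l f y - h y j l * ∑ a, pd a f y * grad h f y a)
      - kron m j * (pd i f y * pd l f y - h y i l * ∑ a, pd a f y * grad h f y a)
      - grad h f y m * (h y i l * pd j f y - h y j l * pd i f y)) := by
  have hg : ∀ m, DifferentiableAt ℝ (fun z => grad h f z m) y := fun m =>
    differentiableAt_of_contDiffOn hh.isOpen (hh.contDiffOn_grad hf m) hy
  have hf2 : ∀ m, DifferentiableAt ℝ (pd m f) y := fun m =>
    differentiableAt_of_contDiffOn hh.isOpen (contDiffOn_pd hh.isOpen hf m) hy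
  have hderiv : ∀ i j, pd i (fun z => christoffel ht z m j l) y =
      pd i (fun z => christoffel h z m j l) y + (kron m j * pd i (pd l f) y
        + kron m l * pd i (pd j f) y - (pd i (fun z => h z j l) y * grad h f y m
        + h y j l * pd i (fun z => grad h f z m) y)) := by
    intro i j
    rw [pd_congr hh.isOpen hy i (fun z hz => hh.christoffel_conformal hf hht hz m j l),
      pd_add i (hh.differentiableAt_christoffel hy _ _ _)
        ((((hf2 l).const_mul _).fun_add ((hf2 j).const_mul _)).fun_sub
          ((hh.differentiableAt_metric hy j l).fun_mul (hg m))),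
      pd_sub i (((hf2 l).const_mul _).fun_add ((hf2 j).const_mul _))
          ((hh.differentiableAt_metric hy j l).fun_mul (hg m)),
      pd_add i ((hf2 l).const_mul _) ((hf2 j).const_mul _),
      pd_const_mul i _ (hf2 l), pd_const_mul i _ (hf2 j),
      pd_mul i (hh.differentiableAt_metric hy j l) (hg m)]
  have hquad : ∀ i j, ∑ a, christoffel ht y m i a * christoffel ht y a j l =
      (∑ a, christoffel h y m i a * christoffel h y a j l)
      + (christoffel h y m i j * pd l f y + christoffel h y m i l * pd j f y
        - h y j l * ∑ a, christoffel h y m i a * grad h f y a)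
      + (kron m i * (∑ a, christoffel h y a j l * pd a f y) + christoffel h y m j l * pd i f y
        - grad h f y m * ∑ a, h y i a * christoffel h y a j l)
      + (kron m i * (2 * (pd j f y * pd l f y) - h y j l * ∑ a, pd a f y * grad h f y a)
        + pd i f y * (kron m j * pd l f y + kron m l * pd j f y - h y j l * grad h f y m)
        - grad h f y m * (h y i j * pd l f y + h y i l * pd j f y - h y j l * pd i f y)) := by
    intro i j
    have k1 := sum_kron_mul' j (fun a => christoffel h y m i a)
    have k2 := sum_kron_mul' l (fun a => christoffel h y m i a)
    have k3 := sum_kron_mul m (fun a => christoffel h y a j l)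
    have k4 := sum_kron_mul' j (fun a => pd a f y)
    have k5 := sum_kron_mul' l (fun a => pd a f y)
    have k6 := sum_kron_mul m (fun a => kron a j)
    have k7 := sum_kron_mul m (fun a => kron a l)
    have k8 := sum_kron_mul m (fun a => grad h f y a)
    have k9 := sum_kron_mul' j (fun a => h y i a)
    have k10 := sum_kron_mul' l (fun a => h y i a)
    have k11 := hh.sum_mul_grad (f := f) hy i
    -- The contractions are first left as sums, so that the identity holds summand by summand; `k1`
    -- to `k11` then evaluate them.
    have expand : ∑ a, christoffel ht y m i a * christoffel ht y a j l =
      (∑ a, christoffel h y m i a * christoffel h y a j l)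
      + ((∑ a, kron a j * christoffel h y m i a) * pd l f y
        + (∑ a, kron a l * christoffel h y m i a) * pd j f y
        - h y j l * ∑ a, christoffel h y m i a * grad h f y a)
      + (kron m i * (∑ a, christoffel h y a j l * pd a f y)
        + (∑ a, kron m a * christoffel h y a j l) * pd i f y
        - grad h f y m * ∑ a, h y i a * christoffel h y a j l)
      + (kron m i * ((∑ a, kron a j * pd a f y) * pd l f y + (∑ a, kron a l * pd a f y) * pd j f y
          - h y j l * ∑ a, pd a f y * grad h f y a)
        + pd i f y * ((∑ a, kron m a * kron a j) * pd l f y + (∑ a, kron m a * kron a l) * pd j f y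
          - h y j l * ∑ a, kron m a * grad h f y a)
        - grad h f y m * ((∑ a, kron a j * h y i a) * pd l f y + (∑ a, kron a l * h y i a) * pd j f y
          - h y j l * ∑ a, h y i a * grad h f y a)) := by
      simp only [hh.christoffel_conformal hf hht hy, Finset.mul_sum, Finset.sum_mul,
        ← Finset.sum_add_distrib, ← Finset.sum_sub_distrib]
      exact Finset.sum_congr rfl fun a _ => by ring
    rw [expand, k1, k2, k3, k4, k5, k6, k7, k8, k9, k10, k11]
    ring
  -- The identity `∇_i h_jl - ∇_j h_il = 0`; its left side is exactly the coefficient of `grad f`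
  -- left over at the end.
  have hcompat : pd i (fun z => h z j l) y - pd j (fun z => h z i l) y
      + (∑ a, h y i a * christoffel h y a j l) - (∑ a, h y j a * christoffel h y a i l) = 0 := by
    rw [hh.pd_metric hy, hh.pd_metric hy, Finset.sum_add_distrib, Finset.sum_add_distrib]
    simp only [hh.christoffel_symm hy _ j i]
    ring
  have e1 := pd_comm hh.isOpen hf hy i j
  have e2 := hh.christoffel_symm hy m i j
  have e3 := hh.symm y hy i j
  simp only [riemannUp, Finset.sum_sub_distrib, hderiv, hquad, hess, covGrad]
  rw [e1, e2, e3]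
  linear_combination (-grad h f y m) * hcompat

/-- Under a conformal change the `(0,4)` curvature tensor is rescaled and changes by a
Kulkarni–Nomizu product with the metric. -/
lemma exists_riemann_conformal (hh : IsMetricOn h U) (hf : ContDiffOn ℝ ∞ f U)
    (hht : ∀ z ∈ U, ∀ i j, ht z i j = Real.exp (2 * f z) * h z i j) (hy : y ∈ U) :
    ∃ A : Fin n → Fin n → ℝ, ∀ i j k l, riemann ht y i j k l =
      Real.exp (2 * f y) * (riemann h y i j k l + kulkarni (h y) A i j k l) := by
  -- The classical tensor `-(∇df - df ⊗ df + ½ |df|² g)`.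
  refine ⟨fun i k => -(hess h f y i k - pd i f y * pd k f y
    + (1 / 2) * (∑ a, pd a f y * grad h f y a) * h y i k), fun i j k l => ?_⟩
  set N := ∑ a, pd a f y * grad h f y a with hN
  have k1 : ∀ i, ∑ m, h y k m * kron m i = h y k i := fun i => by
    simpa [mul_comm] using sum_kron_mul' i (fun a => h y k a)
  have expand : ∑ m, h y k m * riemannUp ht y m l i j = ∑ m, h y k m * riemannUp h y m l i j
      + ((∑ m, h y k m * kron m j) * hess h f y i l - (∑ m, h y k m * kron m i) * hess h f y j l
      - h y j l * (∑ m, h y k m * covGrad h f y m i)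
      + h y i l * (∑ m, h y k m * covGrad h f y m j)
      + (∑ m, h y k m * kron m i) * (pd j f y * pd l f y - h y j l * N)
      - (∑ m, h y k m * kron m j) * (pd i f y * pd l f y - h y i l * N)
      - (∑ m, h y k m * grad h f y m) * (h y i l * pd j f y - h y j l * pd i f y)) := by
    simp only [hh.riemannUp_conformal hf hht hy, ← hN]
    simp only [Finset.mul_sum, Finset.sum_mul, ← Finset.sum_add_distrib, ← Finset.sum_sub_distrib]
    exact Finset.sum_congr rfl fun a _ => by ring
  have : riemann ht y i j k l = Real.exp (2 * f y) * ∑ m, h y k m * riemannUp ht y m l i j := by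
    simp only [riemann, hht y hy, mul_assoc, Finset.mul_sum]
  rw [this, expand, k1, k1, hh.sum_mul_covGrad hf hy, hh.sum_mul_covGrad hf hy,
    hh.sum_mul_grad hy, riemann, hh.symm y hy k i, hh.symm y hy k j]
  simp only [kulkarni]
  ring

end Conformal

end IsMetricOn

end Coord

/-! ### Adapted frames -/

open Matrix in
/-- A symmetric real matrix has an orthonormal basis of eigenvectors. -/
lemma exists_orthonormal_eigenvectors {n : ℕ} {S : Matrix (Fin n) (Fin n) ℝ} (hS : Sᵀ = S) :
    ∃ (Q : Matrix (Fin n) (Fin n) ℝ) (ev : Fin n → ℝ), Qᵀ * Q = 1 ∧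
      ∀ a, S *ᵥ Qᵀ a = ev a • Qᵀ a := by
  have hH : S.IsHermitian := by simpa [Matrix.IsHermitian] using hS
  refine ⟨Matrix.of fun i a => hH.eigenvectorBasis a i, hH.eigenvalues, ?_, fun a => ?_⟩
  · ext a b
    have := orthonormal_iff_ite.1 hH.eigenvectorBasis.orthonormal a b
    rw [Matrix.one_apply, ← this]
    simp [Matrix.mul_apply, PiLp.inner_apply, mul_comm]
  · exact hH.mulVec_eigenvectorBasis a

open Matrix in
/-- A symmetric matrix with `x ≠ 0` in its kernel is diagonalized by an orthonormal basis one of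
whose elements is a multiple of `x`. -/
lemma exists_orthogonal_diagonalizing_with_column {n : ℕ} {S : Matrix (Fin n) (Fin n) ℝ}
    (hS : Sᵀ = S) {x : Fin n → ℝ} (hx : x ≠ 0) (hSx : S *ᵥ x = 0) :
    ∃ Q : Matrix (Fin n) (Fin n) ℝ, Qᵀ * Q = 1 ∧ (∀ a b, a ≠ b → (Qᵀ * S * Q) a b = 0) ∧
      ∃ (a₀ : Fin n) (s : ℝ), ∀ i, Q i a₀ = s * x i := by
  -- Adding `μ x xᵀ / |x|²`, with `μ` outside the spectrum of `S`, moves `x` into a one-dimensional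
  -- eigenspace of its own. Any orthonormal eigenbasis of the perturbed matrix must then contain a
  -- multiple of `x`, and it still diagonalizes `S`.
  obtain ⟨μ, hμ⟩ : ∃ μ : ℝ, ¬ Module.End.HasEigenvalue (Matrix.toLin' S) μ :=
    (Module.End.finite_hasEigenvalue (Matrix.toLin' S)).infinite_compl.nonempty
  have hμ' : ∀ w : Fin n → ℝ, S *ᵥ w = μ • w → w = 0 := by
    intro w hw
    by_contra h0
    exact hμ (Module.End.hasEigenvalue_of_hasEigenvector (x := w)
      ⟨Module.End.mem_eigenspace_iff.2 (by simpa using hw), h0⟩)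
  have hxx : x ⬝ᵥ x ≠ 0 := fun h0 => hx (dotProduct_self_eq_zero.1 h0)
  set t := μ / (x ⬝ᵥ x) with ht
  obtain ⟨Q, ev, hQ, hev⟩ := exists_orthonormal_eigenvectors
    (S := S + t • vecMulVec x x) (by
      rw [transpose_add, hS, transpose_smul, transpose_vecMulVec])
  have hv : ∀ a, S *ᵥ Qᵀ a = ev a • Qᵀ a - (t * (x ⬝ᵥ Qᵀ a)) • x := by
    intro a
    rw [← hev a, add_mulVec, smul_mulVec, vecMulVec_mulVec]
    ext i
    simp
    ring
  have horth : ∀ a b, Qᵀ a ⬝ᵥ Qᵀ b = if a = b then 1 else 0 := by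
    intro a b
    have := congrFun₂ hQ a b
    rw [Matrix.one_apply] at this
    simpa [Matrix.mul_apply, dotProduct] using this
  obtain ⟨a₀, ha₀⟩ : ∃ a, x ⬝ᵥ Qᵀ a ≠ 0 := by
    by_contra! h0
    apply hx
    have h1 : Qᵀ *ᵥ x = 0 := by
      ext a
      exact (dotProduct_comm _ _).trans (h0 a)
    have h2 : Q * Qᵀ = 1 := mul_eq_one_comm.1 hQ
    rw [← one_mulVec x, ← h2, ← mulVec_mulVec, h1, mulVec_zero]
  have hSdot : ∀ w, x ⬝ᵥ S *ᵥ w = 0 := by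
    intro w
    rw [dotProduct_mulVec, ← mulVec_transpose, hS, hSx, zero_dotProduct]
  -- The range of `S` is orthogonal to `x`, so pairing the eigenvector equation with `x` determines
  -- the eigenvalue.
  have hev₀ : ev a₀ = μ := by
    have h1 := hSdot (Qᵀ a₀)
    rw [hv, dotProduct_sub, dotProduct_smul, dotProduct_smul, smul_eq_mul, smul_eq_mul, ht] at h1
    field_simp at h1
    exact sub_eq_zero.1 ((mul_eq_zero.1 h1).resolve_left ha₀)
  -- The part of the column orthogonal to `x` satisfies `S w = μ w`, hence vanishes by the choice of
  -- `μ`.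
  have hcol : Qᵀ a₀ = ((x ⬝ᵥ Qᵀ a₀) / (x ⬝ᵥ x)) • x := by
    rw [← sub_eq_zero]
    apply hμ'
    rw [mulVec_sub, mulVec_smul, hSx, hv, hev₀, ht]
    ext i
    simp
    ring
  have hxa : ∀ a, a ≠ a₀ → x ⬝ᵥ Qᵀ a = 0 := by
    intro a ha
    have h1 := horth a₀ a
    rw [if_neg ha.symm, hcol, smul_dotProduct, smul_eq_mul] at h1
    exact (mul_eq_zero.1 h1).resolve_left (div_ne_zero ha₀ hxx)
  refine ⟨Q, hQ, fun a b hab => ?_, a₀, _, fun i => congrFun hcol i⟩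
  have h1 : (Qᵀ * S * Q) a b = Qᵀ a ⬝ᵥ (S *ᵥ Qᵀ b) := by
    rw [Matrix.mul_assoc, Matrix.mul_apply]
    simp only [dotProduct, mulVec, Matrix.mul_apply, Matrix.transpose_apply]
  rw [h1, hv, dotProduct_sub, dotProduct_smul, dotProduct_smul, horth, if_neg hab,
    dotProduct_comm _ x]
  by_cases hb : b = a₀
  · rw [hxa a (hb ▸ hab)]
    simp
  · rw [hxa b hb]
    simp

open Matrix in
/-- A positive definite `G` and a symmetric `S` with `S x = 0`, `x ≠ 0`, are simultaneously
diagonalized by a `G`-orthonormal basis one of whose elements is a multiple of `x`. -/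
lemma Matrix.PosDef.exists_frame {n : ℕ} {G S : Matrix (Fin n) (Fin n) ℝ} (hG : G.PosDef)
    (hS : Sᵀ = S) {x : Fin n → ℝ} (hx : x ≠ 0) (hSx : S *ᵥ x = 0) :
    ∃ E : Matrix (Fin n) (Fin n) ℝ, Eᵀ * G * E = 1 ∧ (∀ a b, a ≠ b → (Eᵀ * S * E) a b = 0) ∧
      ∃ (a₀ : Fin n) (s : ℝ), ∀ i, E i a₀ = s * x i := by
  obtain ⟨P, ev, hP, hev⟩ := exists_orthonormal_eigenvectors (S := G)
    (by simpa [Matrix.IsHermitian] using hG.isHermitian)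
  have hpos : ∀ a, 0 < ev a := by
    intro a
    have hPa : Pᵀ a ⬝ᵥ Pᵀ a = 1 := by
      have := congrFun₂ hP a a
      rw [Matrix.one_apply_eq] at this
      simpa [Matrix.mul_apply, dotProduct] using this
    have h1 := hG.dotProduct_mulVec_pos (x := Pᵀ a) (by
      intro h0
      rw [h0] at hPa
      simp at hPa)
    rw [hev, star_trivial, dotProduct_smul, hPa] at h1
    simpa using h1
  have hGP : G * P = P * diagonal ev := by
    ext i a
    rw [mul_diagonal]
    have := congrFun (hev a) i
    simpa [mulVec, dotProduct, Matrix.mul_apply, mul_comm] using this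
  -- Scaling the eigenvectors of `G` by `ev⁻¹ᐟ²` gives a `G`-orthonormal frame `E₀` with inverse
  -- `B`. In it `G` is the identity, `S` becomes `E₀ᵀ S E₀` and `x` becomes `B x`, which reduces
  -- everything to the Euclidean case.
  set D := diagonal fun a => (Real.sqrt (ev a))⁻¹ with hD
  set D' := diagonal fun a => Real.sqrt (ev a) with hD'
  have hDD : D * D' = 1 := by
    rw [hD, hD', diagonal_mul_diagonal, ← diagonal_one]
    congr 1
    ext a
    exact inv_mul_cancel₀ (Real.sqrt_pos.2 (hpos a)).ne'
  have hDt : Dᵀ = D := diagonal_transpose _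
  have hE₀ : (P * D)ᵀ * G * (P * D) = 1 := by
    have h1 : (P * D)ᵀ * G * (P * D) = D * (Pᵀ * (G * P)) * D := by
      rw [transpose_mul, hDt]
      simp only [Matrix.mul_assoc]
    rw [h1, hGP, ← Matrix.mul_assoc Pᵀ, hP, one_mul, hD, diagonal_mul_diagonal,
      diagonal_mul_diagonal, ← diagonal_one]
    congr 1
    ext a
    have h2 := Real.sqrt_pos.2 (hpos a)
    have h3 := Real.mul_self_sqrt (hpos a).le
    field_simp
    rw [sq, h3]
  set E₀ := P * D with hE₀'
  set B := D' * Pᵀ with hB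
  have hEB : E₀ * B = 1 := by
    rw [hE₀', hB, Matrix.mul_assoc, ← Matrix.mul_assoc D, hDD, one_mul, mul_eq_one_comm.1 hP]
  have hxE : E₀ *ᵥ (B *ᵥ x) = x := by rw [mulVec_mulVec, hEB, one_mulVec]
  obtain ⟨Q, hQ, hdiag, a₀, s, hs⟩ := exists_orthogonal_diagonalizing_with_column
    (S := E₀ᵀ * S * E₀) (x := B *ᵥ x)
    (by simp only [transpose_mul, transpose_transpose, hS, Matrix.mul_assoc])
    (fun h0 => hx (by rw [← hxE, h0, mulVec_zero]))
    (by rw [← mulVec_mulVec, hxE, ← mulVec_mulVec, hSx, mulVec_zero])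
  refine ⟨E₀ * Q, ?_, fun a b hab => ?_, a₀, s, fun i => ?_⟩
  · have : (E₀ * Q)ᵀ * G * (E₀ * Q) = Qᵀ * (E₀ᵀ * G * E₀) * Q := by
      simp only [transpose_mul, Matrix.mul_assoc]
    rw [this, hE₀, mul_one, hQ]
  · have : (E₀ * Q)ᵀ * S * (E₀ * Q) = Qᵀ * (E₀ᵀ * S * E₀) * Q := by
      simp only [transpose_mul, Matrix.mul_assoc]
    rw [this, hdiag a b hab]
  · conv_rhs => rw [← hxE]
    simp only [Matrix.mul_apply, mulVec, dotProduct, hs, Finset.mul_sum]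
    exact Finset.sum_congr rfl fun j _ => Finset.sum_congr rfl fun k _ => by ring

/-! ### Tensor components in a frame. -/

namespace Coord

variable {n : ℕ}

/-- The components of a bilinear form in the frame given by the columns of `E`. -/
noncomputable def frame₂ (E : Matrix (Fin n) (Fin n) ℝ) (A : Fin n → Fin n → ℝ) (a c : Fin n) : ℝ :=
  ∑ i, ∑ k, E i a * E k c * A i k

/-- The components of a 4-tensor in the frame given by the columns of `E`. -/
noncomputable def frame₄ (E : Matrix (Fin n) (Fin n) ℝ) (T : Fin n → Fin n → Fin n → Fin n → ℝ)
    (a b c d : Fin n) : ℝ :=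
  ∑ i, ∑ j, ∑ k, ∑ l, E i a * E j b * (E k c * E l d * T i j k l)

section Frame

variable {E : Matrix (Fin n) (Fin n) ℝ} {T : Fin n → Fin n → Fin n → Fin n → ℝ}

open Matrix in
lemma frame₂_eq (A : Fin n → Fin n → ℝ) (a c : Fin n) :
    frame₂ E A a c = (Eᵀ * Matrix.of A * E) a c := by
  simp only [frame₂, Matrix.mul_apply, Finset.sum_mul, Matrix.transpose_apply, Matrix.of_apply]
  rw [Finset.sum_comm]
  exact Finset.sum_congr rfl fun i _ => Finset.sum_congr rfl fun k _ => by ring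

lemma frame₄_antisymm_left (hT : ∀ i j k l, T i j k l = -T j i k l) (a b c d : Fin n) :
    frame₄ E T a b c d = -frame₄ E T b a c d := by
  simp only [frame₄, ← Finset.sum_neg_distrib]
  rw [Finset.sum_comm]
  refine Finset.sum_congr rfl fun i _ => Finset.sum_congr rfl fun j _ =>
    Finset.sum_congr rfl fun k _ => Finset.sum_congr rfl fun l _ => ?_
  rw [hT]
  ring

lemma frame₄_swap_right (T : Fin n → Fin n → Fin n → Fin n → ℝ) (a b c d : Fin n) :
    frame₄ E (fun i j k l => T i j l k) a b c d = frame₄ E T a b d c := by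
  simp only [frame₄]
  refine Finset.sum_congr rfl fun i _ => Finset.sum_congr rfl fun j _ => ?_
  rw [Finset.sum_comm]
  exact Finset.sum_congr rfl fun k _ => Finset.sum_congr rfl fun l _ => by ring

lemma frame₄_antisymm_right (hT : ∀ i j k l, T i j k l = -T i j l k) (a b c d : Fin n) :
    frame₄ E T a b c d = -frame₄ E T a b d c := by
  rw [← frame₄_swap_right T a b c d]
  simp only [frame₄, ← Finset.sum_neg_distrib]
  refine Finset.sum_congr rfl fun i _ => Finset.sum_congr rfl fun j _ =>
    Finset.sum_congr rfl fun k _ => Finset.sum_congr rfl fun l _ => ?_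
  rw [hT]
  ring

lemma frame₄_pair_symm (hT : ∀ i j k l, T i j k l = T k l i j) (a b c d : Fin n) :
    frame₄ E T a b c d = frame₄ E T c d a b := by
  simp only [frame₄]
  calc _ = ∑ i, ∑ k, ∑ j, ∑ l, E i a * E j b * (E k c * E l d * T i j k l) :=
        Finset.sum_congr rfl fun i _ => Finset.sum_comm
    _ = ∑ i, ∑ k, ∑ l, ∑ j, E i a * E j b * (E k c * E l d * T i j k l) :=
        Finset.sum_congr rfl fun i _ => Finset.sum_congr rfl fun k _ => Finset.sum_comm
    _ = ∑ k, ∑ i, ∑ l, ∑ j, E i a * E j b * (E k c * E l d * T i j k l) := Finset.sum_comm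
    _ = ∑ k, ∑ l, ∑ i, ∑ j, E i a * E j b * (E k c * E l d * T i j k l) :=
        Finset.sum_congr rfl fun k _ => Finset.sum_comm
    _ = _ := Finset.sum_congr rfl fun k _ => Finset.sum_congr rfl fun l _ =>
        Finset.sum_congr rfl fun i _ => Finset.sum_congr rfl fun j _ => by rw [hT]; ring

lemma frame₄_sub (T T' : Fin n → Fin n → Fin n → Fin n → ℝ) (a b c d : Fin n) :
    frame₄ E (fun i j k l => T i j k l - T' i j k l) a b c d =
      frame₄ E T a b c d - frame₄ E T' a b c d := by
  simp only [frame₄, mul_sub, Finset.sum_sub_distrib]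

lemma frame₄_add (T T' : Fin n → Fin n → Fin n → Fin n → ℝ) (a b c d : Fin n) :
    frame₄ E (fun i j k l => T i j k l + T' i j k l) a b c d =
      frame₄ E T a b c d + frame₄ E T' a b c d := by
  simp only [frame₄, mul_add, Finset.sum_add_distrib]

lemma frame₄_mul (A B : Fin n → Fin n → ℝ) (a b c d : Fin n) :
    frame₄ E (fun i j k l => A i k * B j l) a b c d = frame₂ E A a c * frame₂ E B b d := by
  simp only [frame₄, frame₂, Finset.sum_mul]
  refine Finset.sum_congr rfl fun i _ => ?_
  rw [Finset.sum_comm]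
  simp only [Finset.mul_sum]
  exact Finset.sum_congr rfl fun k _ => Finset.sum_congr rfl fun j _ =>
    Finset.sum_congr rfl fun l _ => by ring

lemma frame₄_kulkarni (h A : Fin n → Fin n → ℝ) (a b c d : Fin n) :
    frame₄ E (kulkarni h A) a b c d =
      kulkarni (frame₂ E h) (frame₂ E A) a b c d := by
  -- An antisymmetrization in the last two indices, up to the order of factors: `frame₄_swap_right`
  -- then reduces all four terms to `frame₄_mul`.
  have : kulkarni h A = fun i j k l => (A i k * h j l + h i k * A j l)
      - (A i l * h j k + h i l * A j k) := by
    ext i j k l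
    simp only [kulkarni]
    ring
  rw [this, frame₄_sub, frame₄_swap_right (fun i j k l => A i k * h j l + h i k * A j l),
    frame₄_add, frame₄_add, frame₄_mul, frame₄_mul, frame₄_mul, frame₄_mul]
  simp only [kulkarni]
  ring

lemma frame₄_eq_zero_of_column {x : Fin n → ℝ} (hx : ∀ i j k, ∑ l, T i j k l * x l = 0)
    {d : Fin n} {s : ℝ} (hs : ∀ i, E i d = s * x i) (a b c : Fin n) : frame₄ E T a b c d = 0 := by
  refine Finset.sum_eq_zero fun i _ => Finset.sum_eq_zero fun j _ => Finset.sum_eq_zero fun k _ => ?_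
  calc _ = E i a * E j b * (E k c * s) * ∑ l, T i j k l * x l := by
        rw [Finset.mul_sum]
        exact Finset.sum_congr rfl fun l _ => by rw [hs]; ring
    _ = 0 := by rw [hx, mul_zero]

/-- Contraction with `g⁻¹ = E Eᵀ` is the trace in the frame. -/
lemma sum_frame₄ {ginv : Fin n → Fin n → ℝ} (hE : ∀ j l, ∑ b, E j b * E l b = ginv j l)
    (a c : Fin n) : ∑ b, frame₄ E T a b c b =
      frame₂ E (fun i k => ∑ j, ∑ l, ginv j l * T i j k l) a c := by
  simp only [frame₄, frame₂, ← hE]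
  rw [Finset.sum_comm]
  refine Finset.sum_congr rfl fun i _ => ?_
  calc _ = ∑ j, ∑ b, ∑ k, ∑ l, E i a * E j b * (E k c * E l b * T i j k l) := Finset.sum_comm
    _ = ∑ j, ∑ k, ∑ b, ∑ l, E i a * E j b * (E k c * E l b * T i j k l) :=
        Finset.sum_congr rfl fun _ _ => Finset.sum_comm
    _ = ∑ j, ∑ k, ∑ l, ∑ b, E i a * E j b * (E k c * E l b * T i j k l) :=
        Finset.sum_congr rfl fun _ _ => Finset.sum_congr rfl fun _ _ => Finset.sum_comm
    _ = ∑ k, ∑ j, ∑ l, ∑ b, E i a * E j b * (E k c * E l b * T i j k l) := Finset.sum_comm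
    _ = _ := by
        simp only [Finset.mul_sum, Finset.sum_mul]
        exact Finset.sum_congr rfl fun k _ => Finset.sum_congr rfl fun j _ =>
          Finset.sum_congr rfl fun l _ => Finset.sum_congr rfl fun b _ => by ring

/-- Raising the last two indices of a tensor in a frame. -/
lemma sum_raise_eq_sum_frame₄ {ginv : Fin n → Fin n → ℝ}
    (hE : ∀ j l, ∑ b, E j b * E l b = ginv j l) (a b k l : Fin n) :
    ∑ i, ∑ j, (∑ p, ∑ q, ginv k p * ginv l q * T i j p q) * (E i a * E j b) =
      ∑ c, ∑ d, frame₄ E T a b c d * (E k c * E l d) := by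
  simp only [frame₄, ← hE, Finset.sum_mul]
  symm
  calc _ = ∑ c, ∑ i, ∑ d, ∑ j, ∑ p, ∑ q,
          E i a * E j b * (E p c * E q d * T i j p q) * (E k c * E l d) :=
        Finset.sum_congr rfl fun _ _ => Finset.sum_comm
    _ = ∑ i, ∑ c, ∑ d, ∑ j, ∑ p, ∑ q,
          E i a * E j b * (E p c * E q d * T i j p q) * (E k c * E l d) := Finset.sum_comm
    _ = ∑ i, ∑ c, ∑ j, ∑ d, ∑ p, ∑ q,
          E i a * E j b * (E p c * E q d * T i j p q) * (E k c * E l d) :=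
        Finset.sum_congr rfl fun _ _ => Finset.sum_congr rfl fun _ _ => Finset.sum_comm
    _ = ∑ i, ∑ j, ∑ c, ∑ d, ∑ p, ∑ q,
          E i a * E j b * (E p c * E q d * T i j p q) * (E k c * E l d) :=
        Finset.sum_congr rfl fun _ _ => Finset.sum_comm
    _ = _ := Finset.sum_congr rfl fun i _ => Finset.sum_congr rfl fun j _ => by
      calc _ = ∑ c, ∑ p, ∑ d, ∑ q,
              E i a * E j b * (E p c * E q d * T i j p q) * (E k c * E l d) :=
            Finset.sum_congr rfl fun _ _ => Finset.sum_comm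
        _ = ∑ p, ∑ c, ∑ d, ∑ q,
              E i a * E j b * (E p c * E q d * T i j p q) * (E k c * E l d) := Finset.sum_comm
        _ = ∑ p, ∑ c, ∑ q, ∑ d,
              E i a * E j b * (E p c * E q d * T i j p q) * (E k c * E l d) :=
            Finset.sum_congr rfl fun _ _ => Finset.sum_congr rfl fun _ _ => Finset.sum_comm
        _ = ∑ p, ∑ q, ∑ c, ∑ d,
              E i a * E j b * (E p c * E q d * T i j p q) * (E k c * E l d) :=
            Finset.sum_congr rfl fun _ _ => Finset.sum_comm
        _ = _ := by
          refine Finset.sum_congr rfl fun p _ => Finset.sum_congr rfl fun q _ => ?_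
          simp only [Finset.mul_sum, Finset.sum_mul]
          exact Finset.sum_congr rfl fun c _ => Finset.sum_congr rfl fun d _ => by ring

end Frame

/-- In dimension 4, an algebraic curvature tensor annihilated by a frame vector and with diagonal
Ricci tensor has only sectional components. -/
lemma eq_zero_of_pairs_ne {r : Fin 4 → Fin 4 → Fin 4 → Fin 4 → ℝ}
    (hl : ∀ a b c d, r a b c d = -r b a c d) (hr : ∀ a b c d, r a b c d = -r a b d c)
    (hp : ∀ a b c d, r a b c d = r c d a b) {e : Fin 4} (he : ∀ a b c, r a b c e = 0)
    (hric : ∀ a c, a ≠ c → ∑ b, r a b c b = 0) {a b c d : Fin 4}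
    (h₁ : ¬ (a = c ∧ b = d)) (h₂ : ¬ (a = d ∧ b = c)) : r a b c d = 0 := by
  have hl' : ∀ a c d, r a a c d = 0 := fun a c d => by linarith [hl a a c d]
  have hr' : ∀ a b c, r a b c c = 0 := fun a b c => by linarith [hr a b c c]
  have he3 : ∀ a b d, r a b e d = 0 := fun a b d => by rw [hr, he, neg_zero]
  have he2 : ∀ a c d, r a e c d = 0 := fun a c d => by rw [hp, he]
  have he1 : ∀ b c d, r e b c d = 0 := fun b c d => by rw [hp, he3]
  -- When `a`, `b`, `c`, `e` are distinct they exhaust the indices, so the `(a, c)` Ricci sum has `r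
  -- a b c b` as its only possibly nonzero term. All other cases vanish by antisymmetry or by `he`.
  have key : ∀ a b c, a ≠ c → r a b c b = 0 := by
    intro a b c hac
    by_cases hab : b = a
    · rw [hab, hl']
    by_cases hbc : b = c
    · rw [hbc, hr']
    by_cases hbe : b = e
    · rw [hbe, he]
    by_cases hae : a = e
    · rw [hae, he1]
    by_cases hce : c = e
    · rw [hce, he3]
    rw [← hric a c hac, Finset.sum_eq_single b]
    · intro x _ hxb
      by_cases hxa : x = a
      · rw [hxa, hl']
      by_cases hxc : x = c
      · rw [hxc, hr']
      by_cases hxe : x = e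
      · rw [hxe, he]
      exfalso
      omega
    · simp
  by_cases hac : a = c
  · subst hac
    rw [hl, hr, neg_neg]
    exact key _ _ _ fun h => h₁ ⟨rfl, h⟩
  by_cases hbd : b = d
  · subst hbd
    exact key _ _ _ hac
  by_cases had : a = d
  · subst had
    rw [hl]
    rw [key _ _ _ fun h => h₂ ⟨rfl, h⟩, neg_zero]
  by_cases hbc : b = c
  · subst hbc
    rw [hr, key _ _ _ had, neg_zero]
  by_cases hab : a = b
  · rw [hab, hl']
  by_cases hcd : c = d
  · rw [hcd, hr']
  by_cases hae : a = e
  · rw [hae, he1]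
  by_cases hbe : b = e
  · rw [hbe, he2]
  by_cases hce : c = e
  · rw [hce, he3]
  by_cases hde : d = e
  · rw [hde, he]
  -- What remains would be four distinct indices, all different from `e`, among only four values.
  exfalso
  omega

end Coord

namespace Coord

namespace IsMetricOn

/-! ### Conformal covariance of the Weyl tensor. -/

section WeylConformal

variable {n : ℕ} {h ht : EuclideanSpace ℝ (Fin n) → Matrix (Fin n) (Fin n) ℝ}
  {U : Set (EuclideanSpace ℝ (Fin n))} {y : EuclideanSpace ℝ (Fin n)}

/-- The diagonal terms contribute `n A + (tr A) h` and each cross term `-A`. This governs the change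
of Ricci under a conformal change. -/
lemma sum_inv_mul_kulkarni (hh : IsMetricOn h U) (hy : y ∈ U) (A : Fin n → Fin n → ℝ)
    (i k : Fin n) : ∑ j, ∑ l, inv h y j l * kulkarni (h y) A i j k l =
      ((n : ℝ) - 2) * A i k + (∑ j, ∑ l, inv h y j l * A j l) * h y i k := by
  have h1 : ∑ j, ∑ l, inv h y j l * h y j l = (n : ℝ) := by
    have : ∀ j, ∑ l, inv h y j l * h y j l = 1 := fun j => by
      simp only [hh.symm y hy j, hh.sum_inv_mul hy, if_true]
    simp [this]
  have h2 : ∑ j, ∑ l, inv h y j l * (A i l * h y j k) = A i k := by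
    rw [Finset.sum_comm]
    have : ∀ l, ∑ j, inv h y j l * (A i l * h y j k) = A i l * if l = k then 1 else 0 := by
      intro l
      rw [← hh.sum_inv_mul hy l k, Finset.mul_sum]
      exact Finset.sum_congr rfl fun j _ => by rw [hh.inv_symm hy j l]; ring
    simp [this]
  have h3 : ∑ j, ∑ l, inv h y j l * (A j k * h y i l) = A i k := by
    have : ∀ j, ∑ l, inv h y j l * (A j k * h y i l) = A j k * if i = j then 1 else 0 := by
      intro j
      rw [← hh.sum_mul_inv hy i j, Finset.mul_sum]
      exact Finset.sum_congr rfl fun l _ => by rw [hh.inv_symm hy j l]; ring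
    simp [this]
  have expand : ∑ j, ∑ l, inv h y j l * kulkarni (h y) A i j k l =
      A i k * (∑ j, ∑ l, inv h y j l * h y j l) + (∑ j, ∑ l, inv h y j l * A j l) * h y i k
      - ∑ j, ∑ l, inv h y j l * (A i l * h y j k)
      - ∑ j, ∑ l, inv h y j l * (A j k * h y i l) := by
    simp only [kulkarni, Finset.mul_sum, Finset.sum_mul, ← Finset.sum_add_distrib,
      ← Finset.sum_sub_distrib]
    exact Finset.sum_congr rfl fun j _ => Finset.sum_congr rfl fun l _ => by ring
  rw [expand, h1, h2, h3]
  ring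

variable {f : EuclideanSpace ℝ (Fin n) → ℝ}

/-- Conformal covariance of the `(0,4)` Weyl tensor. -/
lemma weyl_conformal (hh : IsMetricOn h U) (hf : ContDiffOn ℝ ∞ f U)
    (hht : ∀ z ∈ U, ∀ i j, ht z i j = Real.exp (2 * f z) * h z i j) (hy : y ∈ U)
    (hn₁ : (n : ℝ) - 1 ≠ 0) (hn₂ : (n : ℝ) - 2 ≠ 0) (i j k l : Fin n) :
    weyl ht y i j k l = Real.exp (2 * f y) * weyl h y i j k l := by
  obtain ⟨A, hA⟩ := hh.exists_riemann_conformal hf hht hy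
  set c := Real.exp (2 * f y) with hc
  have hc0 : c ≠ 0 := Real.exp_ne_zero _
  have hinv := hh.inv_conformal hy hc0 (hht y hy)
  set t := ∑ j, ∑ l, inv h y j l * A j l with ht'
  have hric : ∀ i k, ricci ht y i k = ricci h y i k + (((n : ℝ) - 2) * A i k + t * h y i k) := by
    intro i k
    rw [← hh.sum_inv_mul_kulkarni hy A i k]
    simp only [ricci, hA, hinv, ← Finset.sum_add_distrib]
    refine Finset.sum_congr rfl fun j _ => Finset.sum_congr rfl fun l _ => ?_
    field_simp
  have h1 : ∑ j, ∑ l, inv h y j l * h y j l = (n : ℝ) := by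
    have : ∀ j, ∑ l, inv h y j l * h y j l = 1 := fun j => by
      simp only [hh.symm y hy j, hh.sum_inv_mul hy, if_true]
    simp [this]
  have hscal : scalar ht y = c⁻¹ * (scalar h y + 2 * ((n : ℝ) - 1) * t) := by
    have : scalar ht y = c⁻¹ * (scalar h y + ((n : ℝ) - 2) * (∑ j, ∑ l, inv h y j l * A j l)
        + t * ∑ j, ∑ l, inv h y j l * h y j l) := by
      simp only [scalar, hric, hinv, Finset.mul_sum, ← Finset.sum_add_distrib]
      exact Finset.sum_congr rfl fun j _ => Finset.sum_congr rfl fun l _ => by ring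
    rw [this, h1, ← ht']
    ring
  -- The normalization of the Schouten tensor inverts the trace of the Kulkarni–Nomizu product, so
  -- it shifts by exactly `A`, and this cancels the correction of the curvature.
  have hsch : ∀ i k, schouten ht y i k = schouten h y i k + A i k := by
    intro i k
    simp only [schouten, hric, hscal, hht y hy, ← hc]
    field_simp
    ring
  simp only [weyl, hA, hsch, hht y hy, ← hc, kulkarni]
  ring

/-- The two raised indices contribute `e^{-4f}` against the `e^{2f}` of the `(0,4)` tensor. Only an
overall factor remains, so eigenvectors are conformally invariant. -/
lemma weylUp_conformal (hh : IsMetricOn h U) (hf : ContDiffOn ℝ ∞ f U)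
    (hht : ∀ z ∈ U, ∀ i j, ht z i j = Real.exp (2 * f z) * h z i j) (hy : y ∈ U)
    (hn₁ : (n : ℝ) - 1 ≠ 0) (hn₂ : (n : ℝ) - 2 ≠ 0) (i j k l : Fin n) :
    weylUp h y i j k l = Real.exp (2 * f y) * weylUp ht y i j k l := by
  simp only [weylUp, hh.weyl_conformal hf hht hy hn₁ hn₂,
    hh.inv_conformal hy (Real.exp_ne_zero _) (hht y hy), Finset.mul_sum]
  refine Finset.sum_congr rfl fun a _ => Finset.sum_congr rfl fun b _ => ?_
  have := Real.exp_ne_zero (2 * f y)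
  field_simp

end WeylConformal

/-! ### Diagonalizing the Weyl tensor in dimension 4. -/

variable {h : EuclideanSpace ℝ (Fin 4) → Matrix (Fin 4) (Fin 4) ℝ}
  {U : Set (EuclideanSpace ℝ (Fin 4))} {y : EuclideanSpace ℝ (Fin 4)}

open Matrix in
/-- In dimension 4, if the curvature has a nullity vector then the Weyl tensor is diagonalized by
the simple bivectors of an orthonormal frame. -/
lemma exists_frame_weylUp (hh : IsMetricOn h U) (hy : y ∈ U) (hpos : (h y).PosDef)
    {x : Fin 4 → ℝ} (hx : x ≠ 0) (hRx : ∀ i j k, ∑ l, riemann h y i j k l * x l = 0) :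
    ∃ (E : Matrix (Fin 4) (Fin 4) ℝ) (K : Fin 4 → Fin 4 → ℝ), Eᵀ * h y * E = 1 ∧
      ∀ a b k l, ∑ i, ∑ j, weylUp h y i j k l * (E i a * E j b) =
        K a b * (E k a * E l b - E k b * E l a) := by
  have hRl := riemann_antisymm_left h y
  have hRr := hh.riemann_antisymm_right hy
  have hRp := hh.riemann_pair_symm hy
  have hric_symm : ∀ i k, ricci h y i k = ricci h y k i := by
    intro i k
    simp only [ricci]
    rw [Finset.sum_comm]
    exact Finset.sum_congr rfl fun j _ => Finset.sum_congr rfl fun l _ => by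
      rw [hh.inv_symm hy l j, hRp]
  -- The nullity vector lies in the kernel of Ricci, which is what allows a frame adapted to both.
  have hricx : ∀ i, ∑ k, ricci h y i k * x k = 0 := by
    intro i
    simp only [ricci, Finset.sum_mul]
    rw [Finset.sum_comm]
    refine Finset.sum_eq_zero fun j _ => ?_
    rw [Finset.sum_comm]
    refine Finset.sum_eq_zero fun l _ => ?_
    calc _ = -inv h y j l * ∑ k, riemann h y i j l k * x k := by
          rw [Finset.mul_sum]
          exact Finset.sum_congr rfl fun k _ => by rw [hRr i j k l]; ring
      _ = 0 := by rw [hRx, mul_zero]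
  obtain ⟨E, hE, hdiag, e, s, hes⟩ := hpos.exists_frame
    (S := Matrix.of (ricci h y)) (x := x) (by ext i k; exact hric_symm k i) hx
    (by ext i; exact hricx i)
  have hEE : ∀ j l, ∑ b, E j b * E l b = inv h y j l := by
    intro j l
    have h1 : E * Eᵀ * h y = 1 := by
      rw [Matrix.mul_assoc]
      exact mul_eq_one_comm.1 hE
    have h2 := congrFun₂ (Matrix.inv_eq_left_inv h1) j l
    rw [inv, h2]
    simp only [Matrix.mul_apply, Matrix.transpose_apply]
  have hfh : ∀ a c, frame₂ E (h y) a c = if a = c then 1 else 0 := by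
    intro a c
    refine (frame₂_eq _ a c).trans ?_
    rw [← Matrix.one_apply, ← hE]
    rfl
  have hfric : ∀ a c, a ≠ c → frame₂ E (ricci h y) a c = 0 := by
    intro a c hac
    rw [frame₂_eq, hdiag a c hac]
  have hfS : ∀ a c, a ≠ c → frame₂ E (schouten h y) a c = 0 := by
    intro a c hac
    have : frame₂ E (schouten h y) a c = (frame₂ E (ricci h y) a c
        - scalar h y / (2 * (((4 : ℕ) : ℝ) - 1)) * frame₂ E (h y) a c) / (((4 : ℕ) : ℝ) - 2) := by
      simp only [frame₂, schouten, Finset.mul_sum, ← Finset.sum_sub_distrib, Finset.sum_div]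
      exact Finset.sum_congr rfl fun i _ => Finset.sum_congr rfl fun k _ => by ring
    rw [this, hfric a c hac, hfh, if_neg hac]
    simp
  have hfR : ∀ a b c d, ¬ (a = c ∧ b = d) → ¬ (a = d ∧ b = c) →
      frame₄ E (riemann h y) a b c d = 0 := by
    intro a b c d h₁ h₂
    refine eq_zero_of_pairs_ne (frame₄_antisymm_left hRl) (frame₄_antisymm_right hRr)
      (frame₄_pair_symm hRp) (e := e) (fun a b c => frame₄_eq_zero_of_column hRx hes a b c)
      (fun a c hac => ?_) h₁ h₂
    rw [sum_frame₄ hEE, ← hfric a c hac]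
    rfl
  have hW : weyl h y = fun i j k l => riemann h y i j k l
      - kulkarni (h y) (schouten h y) i j k l := rfl
  have hWl : ∀ i j k l, weyl h y i j k l = -weyl h y j i k l := by
    intro i j k l
    simp only [weyl]
    rw [hRl i j k l]
    ring
  have hWr : ∀ i j k l, weyl h y i j k l = -weyl h y i j l k := by
    intro i j k l
    simp only [weyl]
    rw [hRr i j k l]
    ring
  have hfl := frame₄_antisymm_left (E := E) hWl
  have hfr := frame₄_antisymm_right (E := E) hWr
  -- In this frame `g` and the Schouten tensor are both diagonal, so their Kulkarni–Nomizu product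
  -- has only components with matching index pairs, as the curvature does.
  have hfW : ∀ a b c d, ¬ (a = c ∧ b = d) → ¬ (a = d ∧ b = c) →
      frame₄ E (weyl h y) a b c d = 0 := by
    intro a b c d h₁ h₂
    rw [hW, frame₄_sub, hfR a b c d h₁ h₂]
    have : frame₄ E (fun i j k l => kulkarni (h y) (schouten h y) i j k l) a b c d =
        kulkarni (frame₂ E (h y)) (frame₂ E (schouten h y)) a b c d := frame₄_kulkarni _ _ a b c d
    rw [this, kulkarni, hfh, hfh, hfh, hfh]
    by_cases hac : a = c
    · have hbd : b ≠ d := fun hh => h₁ ⟨hac, hh⟩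
      rw [hfS b d hbd, if_neg hbd]
      by_cases had : a = d
      · have hbc : b ≠ c := fun hh => h₂ ⟨had, hh⟩
        rw [hfS b c hbc, if_neg hbc]
        simp
      · rw [hfS a d had, if_neg had]
        simp
    · rw [hfS a c hac, if_neg hac]
      by_cases had : a = d
      · have hbc : b ≠ c := fun hh => h₂ ⟨had, hh⟩
        rw [hfS b c hbc, if_neg hbc]
        simp
      · rw [hfS a d had, if_neg had]
        simp
  have hfW' : ∀ a b c d, frame₄ E (weyl h y) a b c d = frame₄ E (weyl h y) a b a b *
      (kron a c * kron b d - kron a d * kron b c) := by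
    intro a b c d
    by_cases h₁ : a = c ∧ b = d
    · obtain ⟨rfl, rfl⟩ := h₁
      by_cases hab : a = b
      · subst hab
        have := hfl a a a a
        simp [kron]
        linarith
      · simp [kron, hab]
    · by_cases h₂ : a = d ∧ b = c
      · obtain ⟨rfl, rfl⟩ := h₂
        rw [hfr]
        have hab : a ≠ b := fun hab => h₁ ⟨hab, hab.symm⟩
        simp [kron, hab]
      · rw [hfW a b c d h₁ h₂]
        have k₁ : kron a c * kron b d = 0 := by
          simpa [kron] using fun hbd hac => h₁ ⟨hac, hbd⟩
        have k₂ : kron a d * kron b c = 0 := by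
          simpa [kron] using fun hbc had => h₂ ⟨had, hbc⟩
        rw [k₁, k₂, sub_zero, mul_zero]
  refine ⟨E, fun a b => frame₄ E (weyl h y) a b a b, hE, fun a b k l => ?_⟩
  simp only [weylUp]
  rw [sum_raise_eq_sum_frame₄ hEE]
  calc _ = ∑ c, ∑ d, frame₄ E (weyl h y) a b a b *
        (kron a c * kron b d - kron a d * kron b c) * (E k c * E l d) :=
        Finset.sum_congr rfl fun c _ => Finset.sum_congr rfl fun d _ => by rw [hfW' a b c d]
    _ = frame₄ E (weyl h y) a b a b * ((∑ c, kron a c * E k c) * (∑ d, kron b d * E l d)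
        - (∑ c, kron b c * E k c) * (∑ d, kron a d * E l d)) := by
        rw [Finset.sum_mul_sum, Finset.sum_mul_sum]
        simp only [← Finset.sum_sub_distrib, Finset.mul_sum]
        exact Finset.sum_congr rfl fun c _ => Finset.sum_congr rfl fun d _ => by ring
    _ = _ := by rw [sum_kron_mul, sum_kron_mul, sum_kron_mul, sum_kron_mul]

end IsMetricOn

end Coord

namespace Coord

lemma fderiv_eq_zero_of_pd {n : ℕ} {F : EuclideanSpace ℝ (Fin n) → ℝ} {y : EuclideanSpace ℝ (Fin n)}
    (hF : ∀ i, pd i F y = 0) : fderiv ℝ F y = 0 := by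
  have : (fderiv ℝ F y).toLinearMap = 0 :=
    (EuclideanSpace.basisFun (Fin n) ℝ).toBasis.ext fun i => by simpa [pd] using hF i
  ext v
  exact LinearMap.congr_fun this v

end Coord

/-! ### Coordinate frames and coordinate expressions on a manifold. -/

section CoordinateFrame

variable {n : ℕ} {M : Type*} [TopologicalSpace M] [ChartedSpace (EuclideanSpace ℝ (Fin n)) M]
  [IsManifold (𝓡 n) ∞ M] {c q : M}

lemma mem_baseSet_of_mem_source (hq : q ∈ (extChartAt (𝓡 n) c).source) :
    q ∈ (trivializationAt (EuclideanSpace ℝ (Fin n))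
      (TangentSpace (𝓡 n) : M → Type _) c).baseSet := by
  simpa using hq

lemma coordForm_coordVec (hq : q ∈ (extChartAt (𝓡 n) c).source) (i j : Fin n) :
    coordForm c q i (coordVec c q j) = if i = j then 1 else 0 := by
  have h1 := (trivializationAt (EuclideanSpace ℝ (Fin n))
      (TangentSpace (𝓡 n) : M → Type _) c).continuousLinearMapAt_symmL (R := ℝ)
      (mem_baseSet_of_mem_source hq) (EuclideanSpace.single j (1 : ℝ))
  have h2 : coordForm c q i (coordVec c q j) = (EuclideanSpace.single j (1 : ℝ)) i :=
    congrArg (fun v : EuclideanSpace ℝ (Fin n) => v i) h1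
  rw [h2]
  simp

lemma sum_coordForm_smul_coordVec (hq : q ∈ (extChartAt (𝓡 n) c).source)
    (v : TangentSpace (𝓡 n) q) : ∑ i, coordForm c q i v • coordVec c q i = v := by
  set e := trivializationAt (EuclideanSpace ℝ (Fin n)) (TangentSpace (𝓡 n) : M → Type _) c
  have h1 := e.symmL_continuousLinearMapAt (R := ℝ) (mem_baseSet_of_mem_source hq) v
  have h2 : ∑ i, (e.continuousLinearMapAt ℝ q v) i • EuclideanSpace.single i (1 : ℝ) =
      e.continuousLinearMapAt ℝ q v := by
    have := (EuclideanSpace.basisFun (Fin n) ℝ).sum_repr (e.continuousLinearMapAt ℝ q v)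
    simpa using this
  conv_rhs => rw [← h1, ← h2]
  rw [map_sum]
  refine Finset.sum_congr rfl fun i _ => ?_
  rw [map_smul]
  rfl

/-- Read in the trivialization centred at `c`, the section is constant. -/
lemma contMDiffOn_coordVec (c : M) (i : Fin n) :
    ContMDiffOn (𝓡 n) (𝓡 n).tangent ∞
      (fun q => (⟨q, coordVec c q i⟩ : TangentBundle (𝓡 n) M)) (extChartAt (𝓡 n) c).source := by
  set e := trivializationAt (EuclideanSpace ℝ (Fin n)) (TangentSpace (𝓡 n) : M → Type _) c with he
  have h1 : ContMDiffOn (𝓡 n) (𝓡 n).tangent ∞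
      (fun q => (⟨q, coordVec c q i⟩ : TangentBundle (𝓡 n) M)) e.baseSet := by
    refine (e.contMDiffOn_section_baseSet_iff (IB := 𝓡 n) (n := ∞)).2 ?_
    refine (contMDiffOn_const (c := EuclideanSpace.single i (1 : ℝ))).congr fun q hq => ?_
    have h2 := e.continuousLinearMapAt_symmL (R := ℝ) hq (EuclideanSpace.single i (1 : ℝ))
    rwa [e.continuousLinearMapAt_apply_of_mem ℝ hq] at h2
  exact h1.mono fun q hq => mem_baseSet_of_mem_source hq

omit [IsManifold (𝓡 n) ∞ M] in
lemma symm_mem_source {y : EuclideanSpace ℝ (Fin n)} (hy : y ∈ (extChartAt (𝓡 n) c).target) :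
    (extChartAt (𝓡 n) c).symm y ∈ (extChartAt (𝓡 n) c).source :=
  (extChartAt (𝓡 n) c).map_target hy

lemma ContMDiffOn.comp_extChartAt_symm {F : M → ℝ}
    (hF : ContMDiffOn (𝓡 n) 𝓘(ℝ) ∞ F (extChartAt (𝓡 n) c).source) :
    ContDiffOn ℝ ∞ (fun z => F ((extChartAt (𝓡 n) c).symm z)) (extChartAt (𝓡 n) c).target :=
  contMDiffOn_iff_contDiffOn.1
    (hF.comp (contMDiffOn_extChartAt_symm c) fun _ hz => symm_mem_source hz)

/-- The coordinates of a smooth vector field are smooth. -/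
lemma contDiffOn_coordForm {X : (p : M) → TangentSpace (𝓡 n) p}
    (hX : ContMDiff (𝓡 n) (𝓡 n).tangent ∞ (fun p => (⟨p, X p⟩ : TangentBundle (𝓡 n) M)))
    (c : M) (i : Fin n) :
    ContDiffOn ℝ ∞ (fun z => coordForm c ((extChartAt (𝓡 n) c).symm z) i
      (X ((extChartAt (𝓡 n) c).symm z))) (extChartAt (𝓡 n) c).target := by
  set e := trivializationAt (EuclideanSpace ℝ (Fin n)) (TangentSpace (𝓡 n) : M → Type _) c with he
  refine ContMDiffOn.comp_extChartAt_symm (F := fun q => coordForm c q i (X q)) ?_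
  have h1 := (e.contMDiffOn_section_baseSet_iff (IB := 𝓡 n) (n := ∞)).1 hX.contMDiffOn
  have h2 : ContMDiffOn (𝓡 n) 𝓘(ℝ) ∞ (fun q => (e ⟨q, X q⟩).2 i) e.baseSet :=
    (EuclideanSpace.proj (𝕜 := ℝ) i).contMDiff.comp_contMDiffOn h1
  refine (h2.mono fun q hq => mem_baseSet_of_mem_source hq).congr fun q hq => ?_
  rw [← e.continuousLinearMapAt_apply_of_mem ℝ (mem_baseSet_of_mem_source hq)]
  rfl

end CoordinateFrame

/-! ### Metrics in charts, and the length of a parallel field. -/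

namespace SmoothMetric

variable {n : ℕ} {M : Type*} [TopologicalSpace M] [ChartedSpace (EuclideanSpace ℝ (Fin n)) M]
  [IsManifold (𝓡 n) ∞ M] (g : SmoothMetric n M) {c q : M}

lemma coeff_apply (hq : q ∈ (extChartAt (𝓡 n) c).source) (i j : Fin n) :
    g.coeff c (extChartAt (𝓡 n) c q) i j = g.inner q (coordVec c q i) (coordVec c q j) :=
  congrArg (fun q' => g.inner q' (coordVec c q' i) (coordVec c q' j))
    ((extChartAt (𝓡 n) c).left_inv hq)

lemma contDiffOn_coeff (c : M) (i j : Fin n) :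
    ContDiffOn ℝ ∞ (fun z => g.coeff c z i j) (extChartAt (𝓡 n) c).target := by
  refine ContMDiffOn.comp_extChartAt_symm
    (F := fun q => g.inner q (coordVec c q i) (coordVec c q j)) ?_
  intro x hx
  have h1 : ContMDiffWithinAt (𝓡 n) ((𝓡 n).prod 𝓘(ℝ)) ∞
      (fun q => Bundle.TotalSpace.mk' ℝ (E := Bundle.Trivial M ℝ) q
        (g.inner q (coordVec c q i) (coordVec c q j))) (extChartAt (𝓡 n) c).source x :=
    ContMDiffWithinAt.clm_bundle_apply₂ (F₁ := EuclideanSpace ℝ (Fin n))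
      (F₂ := EuclideanSpace ℝ (Fin n)) g.contMDiff.contMDiffAt.contMDiffWithinAt
      (contMDiffOn_coordVec c i x hx) (contMDiffOn_coordVec c j x hx)
  simp only [Bundle.contMDiffWithinAt_totalSpace] at h1
  exact h1.2

lemma inner_eq_sum {v w : TangentSpace (𝓡 n) q} {a b : Fin n → ℝ}
    (hv : v = ∑ i, a i • coordVec c q i) (hw : w = ∑ i, b i • coordVec c q i) :
    g.inner q v w = ∑ k, ∑ l, g.inner q (coordVec c q k) (coordVec c q l) * (a k * b l) := by
  rw [hv, hw]
  simp only [map_sum, map_smul, FunLike.coe_sum, Finset.sum_apply,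
    FunLike.coe_smul, Pi.smul_apply, smul_eq_mul, Finset.mul_sum]
  rw [Finset.sum_comm]
  exact Finset.sum_congr rfl fun k _ => Finset.sum_congr rfl fun l _ => by ring

lemma posDef_coeff {y : EuclideanSpace ℝ (Fin n)} (hy : y ∈ (extChartAt (𝓡 n) c).target) :
    (g.coeff c y).PosDef := by
  refine Matrix.PosDef.of_dotProduct_mulVec_pos ?_ fun x hx => ?_
  · ext i j
    exact g.symm _ _ _
  · have hq := symm_mem_source hy
    set q := (extChartAt (𝓡 n) c).symm y with hq'
    set v : TangentSpace (𝓡 n) q := ∑ i, x i • coordVec c q i with hv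
    have hv0 : v ≠ 0 := by
      intro h0
      apply hx
      ext i
      have h1 : coordForm c q i v = x i := by
        rw [hv, map_sum]
        simp [coordForm_coordVec hq]
      rw [← h1, h0, map_zero]
      rfl
    have h2 := g.pos q v hv0
    rw [g.inner_eq_sum hv hv] at h2
    refine h2.trans_eq ?_
    simp only [dotProduct, Matrix.mulVec, Finset.mul_sum]
    exact Finset.sum_congr rfl fun k _ => Finset.sum_congr rfl fun l _ => by
      change _ = x k * (g.inner q (coordVec c q k) (coordVec c q l) * x l)
      ring

lemma isMetricOn_coeff (c : M) : Coord.IsMetricOn (g.coeff c) (extChartAt (𝓡 n) c).target where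
  isOpen := isOpen_extChartAt_target c
  smooth := g.contDiffOn_coeff c
  symm _ _ _ _ := g.symm _ _ _
  isUnit_det _ hz := (g.posDef_coeff hz).det_pos.ne'.isUnit

variable {g}

/-- A parallel vector field has locally constant length. -/
lemma IsParallel.isLocallyConstant_normSq {X : (p : M) → TangentSpace (𝓡 n) p}
    (hpar : g.IsParallel X)
    (hX : ContMDiff (𝓡 n) (𝓡 n).tangent ∞ (fun p => (⟨p, X p⟩ : TangentBundle (𝓡 n) M))) :
    IsLocallyConstant fun q => g.inner q (X q) (X q) := by
  rw [IsLocallyConstant.iff_exists_open]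
  intro c
  set φ := extChartAt (𝓡 n) c with hφ
  have hT : IsOpen φ.target := isOpen_extChartAt_target c
  have hc : φ c ∈ φ.target := mem_extChartAt_target c
  -- The chart target need not be connected; a ball is, so vanishing derivative gives constancy on
  -- it.
  obtain ⟨r, hr, hball⟩ := Metric.isOpen_iff.1 hT _ hc
  set Xc : Fin n → EuclideanSpace ℝ (Fin n) → ℝ :=
    fun k z => coordForm c (φ.symm z) k (X (φ.symm z)) with hXc
  have hXs : ∀ k, ContDiffOn ℝ ∞ (Xc k) φ.target := fun k => contDiffOn_coordForm hX c k
  set F : EuclideanSpace ℝ (Fin n) → ℝ :=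
    fun z => ∑ k, ∑ l, g.coeff c z k l * (Xc k z * Xc l z) with hF
  have hFs : ContDiffOn ℝ ∞ F φ.target := ContDiffOn.sum fun k _ => ContDiffOn.sum fun l _ =>
    (g.contDiffOn_coeff c k l).mul ((hXs k).mul (hXs l))
  have hFc : ∀ z ∈ Metric.ball (φ c) r, F z = F (φ c) := by
    intro z hz
    refine Metric.isOpen_ball.is_const_of_fderiv_eq_zero (𝕜 := ℝ)
      (convex_ball _ _).isPreconnected ((hFs.mono hball).differentiableOn (by simp))
      (fun w hw => ?_) hz (Metric.mem_ball_self hr)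
    exact Coord.fderiv_eq_zero_of_pd fun i =>
      (g.isMetricOn_coeff c).pd_normSq_eq_zero (hball hw) hXs (fun z hz => hpar c z hz) i
  have hN : ∀ q ∈ φ.source, g.inner q (X q) (X q) = F (φ q) := by
    intro q hq
    rw [g.inner_eq_sum (sum_coordForm_smul_coordVec hq (X q)).symm
      (sum_coordForm_smul_coordVec hq (X q)).symm]
    refine Finset.sum_congr rfl fun k _ => Finset.sum_congr rfl fun l _ => ?_
    rw [g.coeff_apply hq]
    simp only [hXc]
    rw [φ.left_inv hq]
  refine ⟨φ.source ∩ φ ⁻¹' Metric.ball (φ c) r,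
    (continuousOn_extChartAt c).isOpen_inter_preimage (isOpen_extChartAt_source c)
      Metric.isOpen_ball, ⟨mem_extChartAt_source c, Metric.mem_ball_self hr⟩, fun q hq => ?_⟩
  rw [hN q hq.1, hN c (mem_extChartAt_source c), hFc _ hq.2]

/-- A parallel vector field which is not identically zero on any connected component vanishes
nowhere. -/
lemma IsParallel.ne_zero {X : (p : M) → TangentSpace (𝓡 n) p} (hpar : g.IsParallel X)
    (hX : ContMDiff (𝓡 n) (𝓡 n).tangent ∞ (fun p => (⟨p, X p⟩ : TangentBundle (𝓡 n) M)))
    {p : M} (hne : ∃ q ∈ connectedComponent p, X q ≠ 0) : X p ≠ 0 := by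
  obtain ⟨q, hq, hXq⟩ := hne
  intro h0
  have := (hpar.isLocallyConstant_normSq hX).apply_eq_of_isPreconnected
    isPreconnected_connectedComponent hq mem_connectedComponent
  have h1 := g.pos q (X q) hXq
  simp only [h0, map_zero] at this
  linarith

end SmoothMetric

/-! ### Bivectors -/

section Bivectors

variable {V : Type*} [AddCommGroup V] [Module ℝ V]

omit [AddCommGroup V] [Module ℝ V] in
lemma update_pair_one (v w x : V) : Function.update ![v, w] 1 x = ![v, x] := by
  ext i
  fin_cases i <;> rfl

variable (V) in
/-- The wedge product `(v, w) ↦ v ∧ w` as a bilinear map. -/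
noncomputable def wedge : V →ₗ[ℝ] V →ₗ[ℝ] ⋀[ℝ]^2 V :=
  LinearMap.mk₂ ℝ (fun v w => exteriorPower.ιMulti ℝ 2 ![v, w])
    (fun v v' w => AlternatingMap.map_vecCons_add _ ![w] v v')
    (fun c v w => AlternatingMap.map_vecCons_smul _ ![w] c v)
    (fun v w w' => by
      have := (exteriorPower.ιMulti ℝ 2).map_update_add ![v, w] 1 w w'
      simpa only [update_pair_one] using this)
    (fun c v w => by
      have := (exteriorPower.ιMulti ℝ 2).map_update_smul ![v, w] 1 c w
      simpa only [update_pair_one] using this)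

lemma wedge_apply (v w : V) : wedge V v w = exteriorPower.ιMulti ℝ 2 ![v, w] := rfl

lemma wedge_swap (v w : V) : wedge V v w = -wedge V w v := by
  have h0 : ∀ u, wedge V u u = 0 := fun u => by
    rw [wedge_apply]
    exact AlternatingMap.map_eq_zero_of_eq _ _ (i := 0) (j := 1) (by simp) (by simp)
  have h := h0 (v + w)
  simp only [map_add, LinearMap.add_apply, h0, zero_add, add_zero] at h
  rw [add_comm] at h
  exact eq_neg_of_add_eq_zero_left h

lemma wedge_sum_sum {ι : Type*} [Fintype ι] (a b : ι → ℝ) (v : ι → V) :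
    wedge V (∑ k, a k • v k) (∑ l, b l • v l) = ∑ k, ∑ l, (a k * b l) • wedge V (v k) (v l) := by
  simp only [map_sum, map_smul, LinearMap.sum_apply, LinearMap.smul_apply, smul_smul,
    Finset.smul_sum]
  rw [Finset.sum_comm]
  exact Finset.sum_congr rfl fun k _ => Finset.sum_congr rfl fun l _ => by rw [mul_comm]

lemma pairingDual_wedge (α β : Module.Dual ℝ V) (v w : V) :
    exteriorPower.pairingDual ℝ V 2 (exteriorPower.ιMulti ℝ 2 ![α, β]) (wedge V v w) =
      α v * β w - β v * α w := by
  rw [wedge_apply, exteriorPower.pairingDual_ιMulti_ιMulti, Matrix.det_fin_two]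
  simp

end Bivectors

/-- The index pairs of the bivectors `e_a ∧ e_b`, `a < b`, of a frame in dimension 4. -/
def pairIndex : Fin 6 → Fin 4 × Fin 4 := ![(0, 1), (0, 2), (0, 3), (1, 2), (1, 3), (2, 3)]

/-! ### Inner product and Weyl operator on simple bivectors. -/

namespace SmoothMetric

variable {n : ℕ} {M : Type*} [TopologicalSpace M] [ChartedSpace (EuclideanSpace ℝ (Fin n)) M]
  [IsManifold (𝓡 n) ∞ M] (g : SmoothMetric n M) {p : M}

lemma bivectorInner_wedge (v w v' w' : TangentSpace (𝓡 n) p) :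
    g.bivectorInner p (wedge _ v w) (wedge _ v' w') =
      g.inner p v v' * g.inner p w w' - g.inner p w v' * g.inner p v w' := by
  rw [bivectorInner, wedge_apply v w, exteriorPower.map_apply_ιMulti]
  have : (⇑(ContinuousLinearMap.coeLM ℝ ∘ₗ (g.inner p).toLinearMap) ∘ ![v, w] :
      Fin 2 → Module.Dual ℝ (TangentSpace (𝓡 n) p)) =
      ![(g.inner p v).toLinearMap, (g.inner p w).toLinearMap] := by
    ext i
    fin_cases i <;> rfl
  rw [this, pairingDual_wedge]
  rfl

/-- A family which is orthonormal for the inner product of bivectors is linearly independent. -/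
lemma linearIndependent_of_bivectorInner {ι : Type*} [Fintype ι] [DecidableEq ι]
    {b : ι → ⋀[ℝ]^2 (TangentSpace (𝓡 n) p)}
    (hb : ∀ i j, g.bivectorInner p (b i) (b j) = if i = j then 1 else 0) :
    LinearIndependent ℝ b := by
  rw [Fintype.linearIndependent_iff]
  intro c hc i
  have h1 : g.bivectorInner p (∑ j, c j • b j) (b i) = ∑ j, c j * g.bivectorInner p (b j) (b i) := by
    simp [bivectorInner, map_sum, LinearMap.sum_apply]
  rw [hc] at h1
  simp only [hb] at h1
  simpa [bivectorInner] using h1.symm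

/-- A bivector `e_a ∧ e_b` whose coordinates form an eigenvector of `W_{ij}{}^{kl}` is an
eigenvector of the Weyl operator. -/
lemma weylOperator_wedge {E : Matrix (Fin n) (Fin n) ℝ} {K : Fin n → Fin n → ℝ}
    (hW : ∀ a b k l, ∑ i, ∑ j, Coord.weylUp (g.coeff p) (extChartAt (𝓡 n) p p) i j k l *
      (E i a * E j b) = K a b * (E k a * E l b - E k b * E l a)) (a b : Fin n) :
    g.weylOperator p (wedge _ (∑ i, E i a • coordVec p p i) (∑ i, E i b • coordVec p p i)) =
      ((K a b + K b a) / 2) •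
        wedge _ (∑ i, E i a • coordVec p p i) (∑ i, E i b • coordVec p p i) := by
  have hp : p ∈ (extChartAt (𝓡 n) p).source := mem_extChartAt_source p
  set e : Fin n → TangentSpace (𝓡 n) p := fun a => ∑ i, E i a • coordVec p p i with he
  have hform : ∀ i a, coordForm p p i (e a) = E i a := by
    intro i a
    rw [he, map_sum]
    simp [coordForm_coordVec hp]
  set W := Coord.weylUp (g.coeff p) (extChartAt (𝓡 n) p p) with hWdef
  have h1 : g.weylOperator p (wedge _ (e a) (e b)) =
      ∑ i, ∑ j, ∑ k, ∑ l, (W i j k l / 4 * (E i a * E j b - E j a * E i b)) •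
        wedge _ (coordVec p p k) (coordVec p p l) := by
    simp only [weylOperator, LinearMap.sum_apply, LinearMap.smul_apply, LinearMap.smulRight_apply,
      pairingDual_wedge, hform, smul_smul, ← hWdef]
    rfl
  -- No symmetry of `K` is assumed, so antisymmetrizing in `a`, `b` produces its symmetric part.
  -- Half of the factor `1/4` is absorbed later by `e_a ∧ e_b - e_b ∧ e_a = 2 e_a ∧ e_b`.
  have h2 : ∀ k l, ∑ i, ∑ j, W i j k l / 4 * (E i a * E j b - E j a * E i b) =
      (K a b + K b a) / 4 * (E k a * E l b - E k b * E l a) := by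
    intro k l
    have : ∑ i, ∑ j, W i j k l / 4 * (E i a * E j b - E j a * E i b) =
        (1 / 4) * (∑ i, ∑ j, W i j k l * (E i a * E j b) - ∑ i, ∑ j, W i j k l * (E i b * E j a)) := by
      simp only [← Finset.sum_sub_distrib, Finset.mul_sum]
      exact Finset.sum_congr rfl fun i _ => Finset.sum_congr rfl fun j _ => by ring
    rw [this, hW, hW]
    ring
  have h3 : g.weylOperator p (wedge _ (e a) (e b)) =
      ∑ k, ∑ l, ((K a b + K b a) / 4 * (E k a * E l b - E k b * E l a)) •
        wedge _ (coordVec p p k) (coordVec p p l) := by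
    rw [h1]
    calc _ = ∑ i, ∑ k, ∑ j, ∑ l, (W i j k l / 4 * (E i a * E j b - E j a * E i b)) •
          wedge _ (coordVec p p k) (coordVec p p l) :=
          Finset.sum_congr rfl fun i _ => Finset.sum_comm
      _ = ∑ k, ∑ i, ∑ j, ∑ l, (W i j k l / 4 * (E i a * E j b - E j a * E i b)) •
          wedge _ (coordVec p p k) (coordVec p p l) := Finset.sum_comm
      _ = ∑ k, ∑ i, ∑ l, ∑ j, (W i j k l / 4 * (E i a * E j b - E j a * E i b)) •
          wedge _ (coordVec p p k) (coordVec p p l) :=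
          Finset.sum_congr rfl fun _ _ => Finset.sum_congr rfl fun _ _ => Finset.sum_comm
      _ = ∑ k, ∑ l, ∑ i, ∑ j, (W i j k l / 4 * (E i a * E j b - E j a * E i b)) •
          wedge _ (coordVec p p k) (coordVec p p l) :=
          Finset.sum_congr rfl fun _ _ => Finset.sum_comm
      _ = _ := by simp only [← Finset.sum_smul, h2]
  have h4 : wedge _ (e a) (e b) = ∑ k, ∑ l, (E k a * E l b) •
      wedge _ (coordVec p p k) (coordVec p p l) := wedge_sum_sum _ _ _
  have h5 : wedge _ (e b) (e a) = ∑ k, ∑ l, (E k b * E l a) •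
      wedge _ (coordVec p p k) (coordVec p p l) := wedge_sum_sum _ _ _
  have h6 : g.weylOperator p (wedge _ (e a) (e b)) =
      ((K a b + K b a) / 4) • (wedge _ (e a) (e b) - wedge _ (e b) (e a)) := by
    rw [h3, h4, h5]
    simp only [← Finset.sum_sub_distrib, Finset.smul_sum]
    exact Finset.sum_congr rfl fun k _ => Finset.sum_congr rfl fun l _ => by module
  rw [h6, wedge_swap (e b) (e a)]
  module

/-- In an orthonormal frame of a 4-manifold, the six bivectors `e_a ∧ e_b`, `a < b`, are
orthonormal. -/
lemma bivectorInner_pairIndex {M : Type*} [TopologicalSpace M]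
    [ChartedSpace (EuclideanSpace ℝ (Fin 4)) M] [IsManifold (𝓡 4) ∞ M] (g : SmoothMetric 4 M)
    {p : M} {e : Fin 4 → TangentSpace (𝓡 4) p}
    (he : ∀ a b, g.inner p (e a) (e b) = if a = b then 1 else 0) (i j : Fin 6) :
    g.bivectorInner p (wedge _ (e (pairIndex i).1) (e (pairIndex i).2))
      (wedge _ (e (pairIndex j).1) (e (pairIndex j).2)) = if i = j then 1 else 0 := by
  rw [bivectorInner_wedge, he, he, he, he]
  fin_cases i <;> fin_cases j <;> simp [pairIndex]

end SmoothMetric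

/-! ### The eigenbasis at `p`. -/

theorem corollary1p4 {M : Type*} [TopologicalSpace M]
    [ChartedSpace (EuclideanSpace ℝ (Fin 4)) M] [IsManifold (𝓡 4) ∞ M]
    (g : SmoothMetric 4 M)
    (hpar : ∃ gt : SmoothMetric 4 M, g.IsConformal gt ∧
      ∃ X : (p : M) → TangentSpace (𝓡 4) p,
        ContMDiff (𝓡 4) (𝓡 4).tangent ∞ (fun p => (⟨p, X p⟩ : TangentBundle (𝓡 4) M)) ∧
        gt.IsParallel X ∧
        (∀ p : M, ∃ q ∈ connectedComponent p, X q ≠ 0))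
    (p : M) :
    ∃ b : Module.Basis (Fin 6) ℝ (⋀[ℝ]^2 (TangentSpace (𝓡 4) p)),
      (∀ i j, g.bivectorInner p (b i) (b j) = if i = j then 1 else 0) ∧
      ∀ i, IsSimpleBivector (b i) ∧
        ∃ μ : ℝ, (g.weylOperator p).HasEigenvector μ (b i) := by
  obtain ⟨gt, ⟨f, hf, hconf⟩, X, hX, hXpar, hXne⟩ := hpar
  have hXp : X p ≠ 0 := hXpar.ne_zero hX (hXne p)
  have hp : p ∈ (extChartAt (𝓡 4) p).source := mem_extChartAt_source p
  set u := extChartAt (𝓡 4) p p with hu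
  have hut : u ∈ (extChartAt (𝓡 4) p).target := mem_extChartAt_target p
  have hup : (extChartAt (𝓡 4) p).symm u = p := extChartAt_to_inv p
  set fc : EuclideanSpace ℝ (Fin 4) → ℝ := fun z => f ((extChartAt (𝓡 4) p).symm z) with hfc
  have hfcs : ContDiffOn ℝ ∞ fc (extChartAt (𝓡 4) p).target :=
    hf.contMDiffOn.comp_extChartAt_symm
  have hcoeff : ∀ z ∈ (extChartAt (𝓡 4) p).target, ∀ i j,
      gt.coeff p z i j = Real.exp (2 * fc z) * g.coeff p z i j :=
    fun z _ i j => hconf _ _ _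
  have hm := g.isMetricOn_coeff p
  have hmt := gt.isMetricOn_coeff p
  have hxne : (fun k => coordForm p p k (X p)) ≠ 0 := by
    intro h0
    apply hXp
    rw [← sum_coordForm_smul_coordVec hp (X p)]
    exact Finset.sum_eq_zero fun k _ => by rw [congrFun h0 k]; simp
  have hRx : ∀ i j k, ∑ l, Coord.riemann (gt.coeff p) u i j k l * coordForm p p l (X p) = 0 := by
    intro i j k
    have := hmt.sum_riemann_mul_eq_zero hut
      (X := fun k z => coordForm p ((extChartAt (𝓡 4) p).symm z) k
        (X ((extChartAt (𝓡 4) p).symm z)))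
      (fun k => contDiffOn_coordForm hX p k) (fun z hz => hXpar p z hz) i j k
    beta_reduce at this
    rwa [hup] at this
  obtain ⟨E, K, hE, hK⟩ := hmt.exists_frame_weylUp hut (gt.posDef_coeff hut) hxne hRx
  -- Since `gt = e^{2f} g`, multiplying a `gt`-orthonormal frame by `e^f` makes it `g`-orthonormal.
  -- The eigenvector relation is homogeneous in the frame, so it survives the rescaling.
  set s := Real.exp (fc u) with hs
  have hss : Real.exp (2 * fc u) = s * s := by rw [hs, ← Real.exp_add, two_mul]
  have hW : ∀ a b k l, ∑ i, ∑ j, Coord.weylUp (g.coeff p) u i j k l *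
      ((s • E) i a * (s • E) j b) =
      (Real.exp (2 * fc u) * K a b) * ((s • E) k a * (s • E) l b - (s • E) k b * (s • E) l a) := by
    intro a b k l
    have h1 : ∑ i, ∑ j, Coord.weylUp (g.coeff p) u i j k l * ((s • E) i a * (s • E) j b) =
        Real.exp (2 * fc u) * (s * s) *
          ∑ i, ∑ j, Coord.weylUp (gt.coeff p) u i j k l * (E i a * E j b) := by
      simp only [hm.weylUp_conformal hfcs hcoeff hut (by norm_num) (by norm_num), Finset.mul_sum]
      exact Finset.sum_congr rfl fun i _ => Finset.sum_congr rfl fun j _ => by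
        simp only [Matrix.smul_apply, smul_eq_mul]
        ring
    rw [h1, hK]
    simp only [Matrix.smul_apply, smul_eq_mul]
    ring
  set e : Fin 4 → TangentSpace (𝓡 4) p := fun a => ∑ i, (s • E) i a • coordVec p p i with he
  have heo : ∀ a b, g.inner p (e a) (e b) = if a = b then 1 else 0 := by
    intro a b
    rw [← Matrix.one_apply, ← hE, g.inner_eq_sum (c := p) (v := e a) (w := e b) rfl rfl]
    refine Eq.trans ?_ (Coord.frame₂_eq (gt.coeff p u) a b)
    refine Finset.sum_congr rfl fun k _ => Finset.sum_congr rfl fun l _ => ?_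
    rw [hcoeff u hut, hss, hu, g.coeff_apply hp]
    simp only [Matrix.smul_apply, smul_eq_mul]
    ring
  set b : Fin 6 → ⋀[ℝ]^2 (TangentSpace (𝓡 4) p) :=
    fun i => wedge _ (e (pairIndex i).1) (e (pairIndex i).2) with hb
  have hbo : ∀ i j, g.bivectorInner p (b i) (b j) = if i = j then 1 else 0 :=
    g.bivectorInner_pairIndex heo
  have hli := g.linearIndependent_of_bivectorInner hbo
  -- Six independent bivectors span, because `dim Λ² = C(4, 2) = 6`.
  have hcard : Fintype.card (Fin 6) = Module.finrank ℝ (⋀[ℝ]^2 (TangentSpace (𝓡 4) p)) := by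
    have h4 : Module.finrank ℝ (TangentSpace (𝓡 4) p) = 4 :=
      finrank_euclideanSpace_fin (𝕜 := ℝ) (n := 4)
    have : Module.Finite ℝ (TangentSpace (𝓡 4) p) :=
      inferInstanceAs (Module.Finite ℝ (EuclideanSpace ℝ (Fin 4)))
    rw [exteriorPower.finrank_eq, h4]
    rfl
  have hcoe : ∀ i, basisOfLinearIndependentOfCardEqFinrank hli hcard i = b i := fun i => by simp
  refine ⟨basisOfLinearIndependentOfCardEqFinrank hli hcard, fun i j => ?_, fun i => ?_⟩
  · rw [hcoe, hcoe, hbo]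
  · rw [hcoe]
    exact ⟨⟨_, _, rfl⟩, _, Module.End.mem_eigenspace_iff.2 (g.weylOperator_wedge hW _ _),
      hli.ne_zero i⟩
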